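/- **Setting.** Fix a set of constants, a set of basic types $b$ interpreted as sets of constants, and for every constant $c$ a basic type $b_c$ whose interpretation contains $c$. Types $t$ are the regular, contractive, possibly infinite terms of $t ::= b \mid \alpha \mid \boldsymbol\alpha \mid t\to t \mid t\times t \mid t\vee t \mid \neg t \mid \mathbb 0$, where $\alpha$ ranges over polymorphic and $\boldsymbol\alpha$ over monomorphic type variables; $\mathbb 1=\neg\mathbb 0$, $t\wedge s=\neg(\neg t\vee\neg s)$. A type without polymorphic variables is monomorphic (written $m$); a test type $\tau$ is a type without variables in which every arrow is $\mathbb 0\to\mathbb 1$. Subtyping $\le$ is inclusion of the set-theoretic interpretations in the domain of finite terms $d::=c^L\mid(d,d)^L\mid\{(d,\partial),\dots,(d,\partial)\}^L$, $\partial ::= d\mid\Omega$, with $L$ a finite set of type variables, and $\simeq$ is the associated equivalence. $\sigma$ ranges over substitutions of types for polymorphic variables, $\Sigma$ over finite sets of these, $\rho$ over injective renamings of polymorphic variables; $t\Sigma=\bigwedge_{\sigma\in\Sigma}t\sigma$. Write $\mathrm{dom}(t)=\max\{u\mid t\le u\to\mathbb 1\}$, $t\circ s=\min\{u\mid t\le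 s\to u\}$, $\pi_1(t)=\min\{u\mid t\le u\times\mathbb 1\}$, $\pi_2(t)=\min\{u\mid t\le\mathbb 1\times u\}$; these types are determined up to $\simeq$. $\mathrm{tally}(s\,\dot\le\,t)$ is a finite principal set of solutions $\sigma$ of $s\sigma\le t\sigma$. Atoms and canonical forms are $a::=c\mid x\mid\lambda x.\kappa\mid(\mathsf x,\mathsf x)\mid\mathsf x\mathsf x\mid\pi_i\mathsf x\mid(\mathsf x{\in}\tau)?\mathsf x:\mathsf x$ and $\kappa::=\mathsf x\mid\mathsf{bind}\ \mathsf x=a\ \mathsf{in}\ \kappa$, with lambda variables $x$ and binding variables $\mathsf x$. The unwinding $\lceil\cdot\rceil$ inlines the bindings, $\lceil\mathsf{bind}\ \mathsf x=a\ \mathsf{in}\ \kappa\rceil=\lceil\kappa\rceil\{\lceil a\rceil/\mathsf x\}$, and gives an expression of the source language ($\lambda$-calculus with constants, pairs and type-cases). An environment $\Gamma$ is a partial map from variables to types; a rule that mentions $\Gamma(\mathsf x)$ requires $\mathsf x\in\mathrm{dom}(\Gamma)$. *Declarative system* $\Gamma\vdash e:t$: the usual rules for constants, variables, pairs, projections and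 application; from $\Gamma,x:m\vdash e:t$ infer $\Gamma\vdash\lambda x.e:m\to t$; a type-case $(e{\in}\tau)?e_1:e_2$ has type $\mathbb 0$ if $e:\mathbb 0$, type $t_1$ if $e:\tau$ and $e_1:t_1$, type $t_2$ if $e:\neg\tau$ and $e_2:t_2$; intersection introduction; subsumption; instantiation (from $e:t$ infer $e:t\sigma$); and union elimination: from $\Gamma\vdash e':s$, $\Gamma,x:s\wedge m\vdash e:t$ and $\Gamma,x:s\wedge\neg m\vdash e:t$ infer $\Gamma\vdash e\{e'/x\}:t$. *Annotations:* $\mathfrak a::=\varnothing\mid\lambda(m,\mathfrak k)\mid(\rho,\rho)\mid @(\Sigma,\Sigma)\mid\pi(\Sigma)\mid\mathbb 0(\Sigma)\mid{\in_1}(\Sigma)\mid{\in_2}(\Sigma)\mid\bigwedge\{\mathfrak a,\dots,\mathfrak a\}$ for atoms, $\mathfrak k::=\mathsf{var}(\rho)\mid\mathsf{keep}(\mathfrak a,\{(m,\mathfrak k),\dots\})\mid\mathsf{skip}(\mathfrak k)\mid\bigwedge\{\mathfrak k,\dots,\mathfrak k\}$ for forms. *Algorithmic system* $\Gamma\vdash_{\mathcal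 A}[a\mid\mathfrak a]:t$, $\Gamma\vdash_{\mathcal A}[\kappa\mid\mathfrak k]:t$: - $[c\mid\varnothing]:b_c$; $[x\mid\varnothing]:\Gamma(x)$; $[\lambda x.\kappa\mid\lambda(m,\mathfrak k)]:m\to t$ if $\Gamma,x:m\vdash_{\mathcal A}[\kappa\mid\mathfrak k]:t$; - $[\mathsf x_1\mathsf x_2\mid @(\Sigma_1,\Sigma_2)]:t_1\circ t_2$ if $t_i=\Gamma(\mathsf x_i)\Sigma_i$, $t_1\le\mathbb 0\to\mathbb 1$, $t_2\le\mathrm{dom}(t_1)$; - $[(\mathsf x_1,\mathsf x_2)\mid(\rho_1,\rho_2)]:\Gamma(\mathsf x_1)\rho_1\times\Gamma(\mathsf x_2)\rho_2$; $[\pi_i\mathsf x\mid\pi(\Sigma)]:\pi_i(t)$ if $t=\Gamma(\mathsf x)\Sigma\le\mathbb 1\times\mathbb 1$; - $[(\mathsf x{\in}\tau)?\mathsf x_1:\mathsf x_2\mid\cdot]$ has type $\mathbb 0$ with $\mathbb 0(\Sigma)$ if $\Gamma(\mathsf x)\Sigma\simeq\mathbb 0$, type $\Gamma(\mathsf x_1)$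 with $\in_1(\Sigma)$ if $\Gamma(\mathsf x)\Sigma\le\tau$, type $\Gamma(\mathsf x_2)$ with $\in_2(\Sigma)$ if $\Gamma(\mathsf x)\Sigma\le\neg\tau$; - $[\mathsf x\mid\mathsf{var}(\rho)]:\Gamma(\mathsf x)\rho$; $[\mathsf{bind}\ \mathsf x=a\ \mathsf{in}\ \kappa\mid\mathsf{skip}(\mathfrak k)]:t$ if $\mathsf x\notin\mathrm{dom}(\Gamma)$ and $[\kappa\mid\mathfrak k]:t$; $[\mathsf{bind}\ \mathsf x=a\ \mathsf{in}\ \kappa\mid\mathsf{keep}(\mathfrak a,\{(m_i,\mathfrak k_i)\}_{i\in I})]:\bigvee_i t_i$ if $[a\mid\mathfrak a]:s$, $\Gamma,\mathsf x:s\wedge m_i\vdash_{\mathcal A}[\kappa\mid\mathfrak k_i]:t_i$ for all $i$, and $\bigvee_i m_i\simeq\mathbb 1$; - an atom or form annotated with $\bigwedge\{\cdot_i\}_{i\in I}$, $I\ne\varnothing$, has type $\bigwedge_i t_i$ if it has type $t_i$ with each of the annotations. *Intermediate annotations:* $\mathcal L::=\mathsf{infer}\mid\mathsf{untyp}\mid\mathsf{typ}\mid\bigwedge(\{\mathcal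 L,\dots\},\{\mathcal L,\dots\})\mid{\in_1}\mid{\in_2}\mid\lambda(m,\mathcal K)$ for atoms and $\mathcal K::=\mathsf{infer}\mid\mathsf{untyp}\mid\mathsf{typ}\mid\bigwedge(\{\mathcal K,\dots\},\{\mathcal K,\dots\})\mid\mathsf{try\text-skip}(\mathcal K)\mid\mathsf{try\text-keep}(\mathcal L,\mathcal K,\mathcal K)\mid\mathsf{propagate}(\mathcal L,\{\Gamma,\dots\},\mathcal S,\mathcal S)\mid\mathsf{skip}(\mathcal K)\mid\mathsf{keep}(\mathcal L,\mathcal S,\mathcal S)$ for forms, with $\mathcal S::=\{(m,\mathcal K),\dots\}$. *Reconstruction of annotations* $\Gamma\vdash_{\mathcal P}\langle a\mid\mathcal L\rangle\Rightarrow\mathfrak a$, $\Gamma\vdash_{\mathcal P}\langle\kappa\mid\mathcal K\rangle\Rightarrow\mathfrak k$, where $\rho_t$ renames the polymorphic variables of $t$ to fresh ones and $\alpha,\beta$ are fresh polymorphic variables: - with $\mathsf{typ}$: $c\Rightarrow\varnothing$; $x\Rightarrow\varnothing$ if $x\in\mathrm{dom}(\Gamma)$; $(\mathsf x_1,\mathsf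 x_2)\Rightarrow(\rho_{\Gamma(\mathsf x_1)},\rho_{\Gamma(\mathsf x_2)})$; $\mathsf x\Rightarrow\mathsf{var}(\rho_{\Gamma(\mathsf x)})$; $\pi_i\mathsf x\Rightarrow\pi(\Sigma)$ if $\Sigma=\mathrm{tally}(\Gamma(\mathsf x)\,\dot\le\,\alpha\times\beta)\ne\varnothing$; $\mathsf x_1\mathsf x_2\Rightarrow @(\{\sigma\circ\rho_1\}_{\sigma\in\Sigma},\{\sigma\circ\rho_2\}_{\sigma\in\Sigma})$ if $\rho_i=\rho_{\Gamma(\mathsf x_i)}$ and $\Sigma=\mathrm{tally}(\Gamma(\mathsf x_1)\rho_1\,\dot\le\,\Gamma(\mathsf x_2)\rho_2\to\alpha)\ne\varnothing$; $(\mathsf x{\in}\tau)?\mathsf x_1:\mathsf x_2\Rightarrow\mathbb 0(\{\sigma\})$ if $\sigma\in\mathrm{tally}(\Gamma(\mathsf x)\,\dot\le\,\mathbb 0)$, $\Rightarrow{\in_1}(\{\sigma\})$ if $\sigma\in\mathrm{tally}(\Gamma(\mathsf x)\,\dot\le\,\tau)$ and $\mathsf x_1\in\mathrm{dom}(\Gamma)$,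 $\Rightarrow{\in_2}(\{\sigma\})$ if $\sigma\in\mathrm{tally}(\Gamma(\mathsf x)\,\dot\le\,\neg\tau)$ and $\mathsf x_2\in\mathrm{dom}(\Gamma)$; - $\langle\lambda x.\kappa\mid\lambda(m,\mathcal K)\rangle\Rightarrow\lambda(m,\mathfrak k)$ if $\Gamma,x:m\vdash_{\mathcal P}\langle\kappa\mid\mathcal K\rangle\Rightarrow\mathfrak k$; - $\langle\mathsf{bind}\ \mathsf x=a\ \mathsf{in}\ \kappa\mid\mathsf{skip}(\mathcal K)\rangle\Rightarrow\mathsf{skip}(\mathfrak k)$ if $\mathsf x\notin\mathrm{dom}(\Gamma)$ and $\langle\kappa\mid\mathcal K\rangle\Rightarrow\mathfrak k$; - $\langle\mathsf{bind}\ \mathsf x=a\ \mathsf{in}\ \kappa\mid\mathsf{keep}(\mathcal L,\varnothing,\{(m_i,\mathcal K_i)\}_i)\rangle\Rightarrow\mathsf{keep}(\mathfrak a,\{(m_i,\mathfrak k_i)\}_i)$ if $\langle a\mid\mathcal L\rangle\Rightarrow\mathfrak a$, $\Gamma\vdash_{\mathcal A}[a\mid\mathfrak a]:s$, $\Gamma,\mathsf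 x:s\wedge m_i\vdash_{\mathcal P}\langle\kappa\mid\mathcal K_i\rangle\Rightarrow\mathfrak k_i$ for all $i$, and $\bigvee_i m_i\simeq\mathbb 1$; - an intermediate annotation $\bigwedge(\varnothing,\{\cdot_i\}_{i\in I})$ with $I\neq\varnothing$ is turned into the $\bigwedge$ of the annotations obtained from its members. **Theorem (Soundness of reconstruction).** For every environment $\Gamma$: 1. if $\Gamma\vdash_{\mathcal P}\langle\kappa\mid\mathcal K\rangle\Rightarrow\mathfrak k$, then there is a type $t$ such that $\Gamma\vdash_{\mathcal A}[\kappa\mid\mathfrak k]:t$ and, in the declarative system, $\Gamma\vdash\lceil\kappa\rceil:t$; 2. if $\Gamma\vdash_{\mathcal P}\langle a\mid\mathcal L\rangle\Rightarrow\mathfrak a$, then there is a type $t$ such that $\Gamma\vdash_{\mathcal A}[a\mid\mathfrak a]:t$ and $\Gamma\vdash\lceil a\rceil:t$. -/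

import Mathlib

/-! Set-theoretic polymorphic types, canonical forms, the declarative and algorithmic type systems,
and the system that turns intermediate annotations into annotations. -/

namespace PolyDyn

universe u v

/-! ### Types -/

/-- Type variables: two disjoint countable sets, the polymorphic and the monomorphic ones. -/
inductive TVar : Type
  | poly (n : ℕ)
  | mono (n : ℕ)
  deriving DecidableEq

/-- Root symbols of type terms over a set `B` of basic types. -/
inductive TyHead (B : Type v) : Type v
  | base (b : B)
  | var (a : TVar)
  | arrow
  | prod
  | union
  | neg
  | empty

/-- The positions of the immediate sub-terms below a root symbol
(for the binary symbols: `false` is left, `true` is right). -/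
def TyHead.Arity {B : Type v} : TyHead B → Type
  | .arrow => Bool
  | .prod => Bool
  | .union => Bool
  | .neg => Unit
  | _ => Empty

theorem TyHead.finite_arity {B : Type v} (h : TyHead B) : Finite h.Arity := by
  cases h <;> simp only [TyHead.Arity] <;> infer_instance

/-- The signature of the grammar of types. -/
def TyF (B : Type v) : PFunctor.{v, 0} := ⟨TyHead B, TyHead.Arity⟩

/-- Arbitrary finite or infinite terms of the grammar of types. -/
abbrev RawTy (B : Type v) : Type v := (TyF B).M

namespace RawTy

variable {B : Type v}

/-- `IsChild t s`: `s` is an immediate sub-term of `t`. -/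
def IsChild (t s : RawTy B) : Prop := ∃ i, s = t.dest.2 i

/-- `Subterm t s`: `s` is a sub-term of `t`. -/
def Subterm (t s : RawTy B) : Prop := Relation.ReflTransGen IsChild t s

/-- Every term has finitely many different sub-terms. -/
def Regular (t : RawTy B) : Prop := {s | Subterm t s}.Finite

/-- Every infinite branch of the term contains infinitely many arrows or products. -/
def Contractive (t : RawTy B) : Prop :=
  ∀ f : ℕ → RawTy B, f 0 = t → (∀ n, IsChild (f n) (f (n + 1))) →
    ∀ N, ∃ n, N ≤ n ∧ ((f n).dest.1 = TyHead.arrow ∨ (f n).dest.1 = TyHead.prod)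

/-- `BoolChild s t`: `s` is an immediate sub-term of `t` and the root of `t` is not a type
constructor (hence is a union or a negation). -/
def BoolChild (s t : RawTy B) : Prop :=
  IsChild t s ∧ t.dest.1 ≠ TyHead.arrow ∧ t.dest.1 ≠ TyHead.prod

theorem Contractive.of_child {t s : RawTy B} (h : Contractive t) (hs : IsChild t s) :
    Contractive s := by
  intro f f0 hf N
  obtain ⟨n, hn, h'⟩ := h (fun n => Nat.casesOn n t f) rfl
    (by rintro (_ | n); exacts [show IsChild t (f 0) from f0 ▸ hs, hf n]) (N + 1)
  obtain _ | n := n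
  · omega
  · exact ⟨n, by omega, h'⟩

theorem Contractive.of_subterm {t s : RawTy B} (h : Contractive t) (hs : Subterm t s) :
    Contractive s := by
  induction hs with
  | refl => exact h
  | tail _ h2 ih => exact ih.of_child h2

theorem Contractive.acc {t : RawTy B} (h : Contractive t) : Acc BoolChild t := by
  rw [acc_iff_isEmpty_descending_chain]
  refine ⟨fun ⟨f, f0, hf⟩ => ?_⟩
  obtain ⟨n, -, h'⟩ := h f f0 (fun n => (hf n).1) 0
  exact h'.elim (hf n).2.1 (hf n).2.2

theorem contractive_of_acc {t : RawTy B} (h : ∀ s, Subterm t s → Acc BoolChild s) :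
    Contractive t := by
  intro f f0 hf N
  by_contra hcon
  push Not at hcon
  have hsub : ∀ n, Subterm t (f n) := by
    intro n
    induction n with
    | zero => rw [f0]; exact .refl
    | succ n ih => exact ih.tail (hf n)
  refine not_acc_iff_exists_descending_chain.mpr
    ⟨fun n => f (N + n), rfl, fun n => ⟨hf (N + n), hcon (N + n) (by omega)⟩⟩ (h _ (hsub (N + 0)))

theorem subterm_mk {h : TyHead B} {f : h.Arity → RawTy B} {s : RawTy B}
    (hs : Subterm (PFunctor.M.mk (F := TyF B) ⟨h, f⟩) s) :
    s = PFunctor.M.mk (F := TyF B) ⟨h, f⟩ ∨ ∃ i, Subterm (f i) s := by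
  rcases Relation.ReflTransGen.cases_head hs with h1 | ⟨c, ⟨i, hi⟩, h2⟩
  · exact .inl h1.symm
  · refine .inr ⟨i, ?_⟩
    have : c = f i := hi
    exact this ▸ h2

theorem regular_mk (h : TyHead B) (f : h.Arity → RawTy B) (hf : ∀ i, Regular (f i)) :
    Regular (PFunctor.M.mk (F := TyF B) ⟨h, f⟩) := by
  have := h.finite_arity
  refine ((Set.finite_singleton (PFunctor.M.mk (F := TyF B) ⟨h, f⟩)).union
    (Set.finite_iUnion hf)).subset ?_
  intro s hs
  rcases subterm_mk hs with h1 | ⟨i, hi⟩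
  · exact .inl h1
  · exact .inr (Set.mem_iUnion.2 ⟨i, hi⟩)

theorem contractive_mk (h : TyHead B) (f : h.Arity → RawTy B) (hf : ∀ i, Contractive (f i)) :
    Contractive (PFunctor.M.mk (F := TyF B) ⟨h, f⟩) := by
  refine contractive_of_acc fun s hs => ?_
  rcases subterm_mk hs with rfl | ⟨i, hi⟩
  · refine ⟨_, ?_⟩
    rintro s ⟨⟨i, hi⟩, -⟩
    have : s = f i := hi
    exact this ▸ (hf i).acc
  · exact ((hf i).of_subterm hi).acc

end RawTy

/-- Types: the regular and contractive terms. -/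
structure Ty (B : Type v) : Type v where
  raw : RawTy B
  regular : raw.Regular
  contractive : raw.Contractive

namespace Ty

variable {B : Type v}

/-- The type with a given root symbol and given immediate sub-terms. -/
def mkHead (h : TyHead B) (f : h.Arity → Ty B) : Ty B where
  raw := PFunctor.M.mk (F := TyF B) ⟨h, fun i => (f i).raw⟩
  regular := RawTy.regular_mk h _ fun i => (f i).regular
  contractive := RawTy.contractive_mk h _ fun i => (f i).contractive

def base (b : B) : Ty B := mkHead (.base b) Empty.elim
def var (a : TVar) : Ty B := mkHead (.var a) Empty.elim
def arrow (t s : Ty B) : Ty B := mkHead .arrow fun i => Bool.rec t s i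
def prod (t s : Ty B) : Ty B := mkHead .prod fun i => Bool.rec t s i
def union (t s : Ty B) : Ty B := mkHead .union fun i => Bool.rec t s i
def neg (t : Ty B) : Ty B := mkHead .neg fun _ => t
def empty : Ty B := mkHead .empty Empty.elim

def any : Ty B := neg empty
def inter (t s : Ty B) : Ty B := neg (union (neg t) (neg s))

/-- The polymorphic type variable with index `n`. -/
def pvar (n : ℕ) : Ty B := var (.poly n)

/-- Finite unions; the empty one is the empty type. -/
def bigUnion (l : List (Ty B)) : Ty B := l.foldr union empty

/-- Finite intersections; the empty one is the top type. -/
def bigInter (l : List (Ty B)) : Ty B := l.foldr inter any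

/-- The root symbol of a type together with its immediate sub-terms. -/
def dest (t : Ty B) : (h : TyHead B) × (h.Arity → Ty B) :=
  ⟨t.raw.dest.1, fun i =>
    ⟨t.raw.dest.2 i,
      t.regular.subset fun _ hs => Relation.ReflTransGen.head ⟨i, rfl⟩ hs,
      t.contractive.of_child ⟨i, rfl⟩⟩⟩

/-- The type variables that occur in a type. -/
def vars (t : Ty B) : Set TVar := {a | ∃ s, t.raw.Subterm s ∧ s.dest.1 = TyHead.var a}

/-- The (indices of the) polymorphic type variables that occur in a type. -/
def polyVars (t : Ty B) : Set ℕ := {n | TVar.poly n ∈ t.vars}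

/-- A type is monomorphic if no polymorphic type variable occurs in it. -/
def IsMono (t : Ty B) : Prop := t.polyVars = ∅

/-- Test types: ground types whose only arrow sub-terms are `empty → any`. -/
def IsTest (t : Ty B) : Prop :=
  t.vars = ∅ ∧ ∀ s, t.raw.Subterm s → s.dest.1 = TyHead.arrow → s = (arrow empty any : Ty B).raw

/-- `BoolLT s t`: `t` is a union or a negation and `s` is one of its immediate sub-terms. -/
def BoolLT (s t : Ty B) : Prop := RawTy.BoolChild s.raw t.raw

theorem wf_boolLT : WellFounded (BoolLT (B := B)) :=
  ⟨fun t => InvImage.accessible raw t.contractive.acc⟩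

instance : WellFoundedRelation (Ty B) := ⟨BoolLT, wf_boolLT⟩

theorem boolLT_of_dest {t : Ty B} {h : TyHead B} {f : h.Arity → Ty B} (e : t.dest = ⟨h, f⟩)
    (h1 : h ≠ .arrow) (h2 : h ≠ .prod) (i : h.Arity) : BoolLT (f i) t := by
  unfold dest at e
  cases e
  exact ⟨⟨i, rfl⟩, h1, h2⟩

/-- The value of the Boolean combination `t`, where `p` gives the value of the sub-terms that are
basic types, variables, arrows or products. -/
def evalBool (p : Ty B → Prop) (t : Ty B) : Prop :=
  match _e : t.dest with
  | ⟨.union, f⟩ => evalBool p (f false) ∨ evalBool p (f true)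
  | ⟨.neg, f⟩ => ¬ evalBool p (f ())
  | ⟨.empty, _⟩ => False
  | _ => p t
termination_by t
decreasing_by
  all_goals exact boolLT_of_dest _e (by simp) (by simp) _

end Ty

/-- Monomorphic types. -/
abbrev MonoTy (B : Type v) : Type v := {t : Ty B // t.IsMono}

/-- Test types. -/
abbrev TestTy (B : Type v) : Type v := {t : Ty B // t.IsTest}

/-! ### Substitutions -/

namespace RawTy

variable {B : Type v}

/-- One step of a substitution: on `inl t` the substitution still has to be applied to `t`, while
`inr t` is copied. -/
def substStep (θ : TVar → RawTy B) : RawTy B ⊕ RawTy B → (TyF B) (RawTy B ⊕ RawTy B)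
  | .inr t => (TyF B).map .inr t.dest
  | .inl t =>
    match t.dest with
    | ⟨.var a, _⟩ => (TyF B).map .inr (θ a).dest
    | d => (TyF B).map .inl d

/-- Simultaneous replacement of the type variables in a term. -/
def subst (θ : TVar → RawTy B) (t : RawTy B) : RawTy B :=
  PFunctor.M.corec (substStep θ) (.inl t)

theorem corec_inr (θ : TVar → RawTy B) (t : RawTy B) :
    PFunctor.M.corec (substStep θ) (.inr t) = t := by
  refine PFunctor.M.bisim (fun x y => x = PFunctor.M.corec (substStep θ) (.inr y)) ?_ _ t rfl
  rintro _ y rfl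
  refine ⟨y.dest.1, fun i => PFunctor.M.corec (substStep θ) (.inr (y.dest.2 i)), y.dest.2,
    ?_, rfl, fun i => rfl⟩
  rw [PFunctor.M.dest_corec]
  rfl

theorem subst_var (θ : TVar → RawTy B) {t : RawTy B} {a : TVar}
    (h : t.dest.1 = TyHead.var a) : subst θ t = θ a := by
  obtain ⟨h', f, e⟩ : ∃ h' f, t.dest = ⟨h', f⟩ := ⟨_, _, rfl⟩
  rw [e] at h
  cases h
  have h3 : PFunctor.M.dest (subst θ t) = PFunctor.M.dest (θ a) := by
    rw [subst, PFunctor.M.dest_corec]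
    have : substStep θ (.inl t) = (TyF B).map .inr (θ a).dest := by
      simp only [substStep]
      rw [e]
    rw [this]
    refine Sigma.ext rfl (heq_of_eq (funext fun i => ?_))
    exact corec_inr θ _
  rw [← PFunctor.M.mk_dest (subst θ t), h3, PFunctor.M.mk_dest]

theorem dest_subst (θ : TVar → RawTy B) {t : RawTy B}
    (h : ∀ a, t.dest.1 ≠ TyHead.var a) :
    (subst θ t).dest = ⟨t.dest.1, fun i => subst θ (t.dest.2 i)⟩ := by
  obtain ⟨h', f, e⟩ : ∃ h' f, t.dest = ⟨h', f⟩ := ⟨_, _, rfl⟩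
  rw [e] at h
  have : substStep θ (.inl t) = (TyF B).map .inl t.dest := by
    simp only [substStep]
    rw [e]
    cases h' <;> first | rfl | exact absurd rfl (h _)
  rw [subst, PFunctor.M.dest_corec, this]
  rfl

theorem subterm_subst (θ : TVar → RawTy B) {t s : RawTy B} (hs : Subterm (subst θ t) s) :
    (∃ r, Subterm t r ∧ s = subst θ r) ∨
      ∃ r a, Subterm t r ∧ r.dest.1 = TyHead.var a ∧ Subterm (θ a) s := by
  induction hs with
  | refl => exact .inl ⟨t, .refl, rfl⟩
  | @tail b c _ hc ih =>
    rcases ih with ⟨r, hr, rfl⟩ | ⟨r, a, hr, ha, h⟩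
    · by_cases hv : ∃ a, r.dest.1 = TyHead.var a
      · obtain ⟨a, ha⟩ := hv
        rw [subst_var θ ha] at hc
        exact .inr ⟨r, a, hr, ha, .single hc⟩
      · obtain ⟨i, hi⟩ := hc
        have hd := dest_subst θ (fun a ha => hv ⟨a, ha⟩)
        obtain ⟨d, hd'⟩ : ∃ d, (subst θ r).dest = d := ⟨_, rfl⟩
        have : ∃ j, c = subst θ (r.dest.2 j) := by
          rw [hd'] at hd
          subst hd
          revert i
          rw [hd']
          rintro i hi
          exact ⟨i, hi⟩
        obtain ⟨j, rfl⟩ := this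
        exact .inl ⟨_, hr.tail ⟨j, rfl⟩, rfl⟩
    · exact .inr ⟨r, a, hr, ha, h.tail hc⟩

theorem regular_subst (θ : TVar → RawTy B) (hθ : ∀ a, Regular (θ a)) {t : RawTy B}
    (ht : Regular t) : Regular (subst θ t) := by
  have h1 : (subst θ '' {r | Subterm t r}).Finite := ht.image _
  have h2 : (⋃ r ∈ {r | Subterm t r}, {s | ∃ a, r.dest.1 = TyHead.var a ∧ Subterm (θ a) s}).Finite := by
    refine ht.biUnion fun r _ => ?_
    by_cases hv : ∃ a, r.dest.1 = TyHead.var a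
    · obtain ⟨a, ha⟩ := hv
      refine (hθ a).subset ?_
      rintro s ⟨b, hb, hs⟩
      rw [ha] at hb
      cases hb
      exact hs
    · refine Set.finite_empty.subset ?_
      rintro s ⟨b, hb, hs⟩
      exact hv ⟨b, hb⟩
  refine (h1.union h2).subset ?_
  intro s hs
  rcases subterm_subst θ hs with ⟨r, hr, rfl⟩ | ⟨r, a, hr, ha, h⟩
  · exact .inl ⟨r, hr, rfl⟩
  · exact .inr (Set.mem_biUnion hr ⟨a, ha, h⟩)

theorem acc_subst (θ : TVar → RawTy B) (hθ : ∀ a, Contractive (θ a)) {t : RawTy B}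
    (ht : Acc BoolChild t) : Acc BoolChild (subst θ t) := by
  induction ht with
  | intro t _ ih =>
    by_cases hv : ∃ a, t.dest.1 = TyHead.var a
    · obtain ⟨a, ha⟩ := hv
      rw [subst_var θ ha]
      exact (hθ a).acc
    · have hd := dest_subst θ (fun a ha => hv ⟨a, ha⟩)
      refine ⟨_, ?_⟩
      rintro s ⟨⟨i, hi⟩, h1, h2⟩
      have : t.dest.1 ≠ TyHead.arrow ∧ t.dest.1 ≠ TyHead.prod ∧
          ∃ j, s = subst θ (t.dest.2 j) := by
        revert i
        rw [hd] at h1 h2 ⊢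
        exact fun i hi => ⟨h1, h2, i, hi⟩
      obtain ⟨h1, h2, j, rfl⟩ := this
      exact ih _ ⟨⟨j, rfl⟩, h1, h2⟩

theorem contractive_subst (θ : TVar → RawTy B) (hθ : ∀ a, Contractive (θ a)) {t : RawTy B}
    (ht : Contractive t) : Contractive (subst θ t) := by
  refine contractive_of_acc fun s hs => ?_
  rcases subterm_subst θ hs with ⟨r, hr, rfl⟩ | ⟨r, a, hr, ha, h⟩
  · exact acc_subst θ hθ (ht.of_subterm hr).acc
  · exact ((hθ a).of_subterm h).acc

end RawTy

/-- Substitutions from polymorphic type variables to types. -/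
abbrev PSubst (B : Type v) : Type v := ℕ → Ty B

namespace Ty

variable {B : Type v}

/-- Simultaneous replacement of the type variables in a type. -/
def substVars (θ : TVar → Ty B) (t : Ty B) : Ty B where
  raw := t.raw.subst fun a => (θ a).raw
  regular := RawTy.regular_subst _ (fun a => (θ a).regular) t.regular
  contractive := RawTy.contractive_subst _ (fun a => (θ a).contractive) t.contractive

/-- The instance `tσ`: only polymorphic variables are replaced. -/
def inst (t : Ty B) (σ : PSubst B) : Ty B :=
  t.substVars fun
    | .poly n => σ n
    | .mono n => var (.mono n)

/-- The instance `tΣ` under a finite set of substitutions: the intersection of all `tσ`. -/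
def instSet (t : Ty B) (S : List (PSubst B)) : Ty B := bigInter (S.map fun σ => t.inst σ)

end Ty

/-- Renamings of polymorphic variables: injective finite maps from polymorphic variables to
polymorphic variables, extended by the identity outside of their domain. -/
structure Renaming where
  dom : Finset ℕ
  toFun : ℕ → ℕ
  inj : Set.InjOn toFun dom
  id_of_notMem : ∀ n, n ∉ dom → toFun n = n

/-- A renaming, seen as a substitution. -/
def Renaming.toSubst {B : Type v} (ρ : Renaming) : PSubst B := fun n => Ty.pvar (ρ.toFun n)

/-- The composition of a substitution with a renaming (the renaming acts first). -/
def PSubst.compRenaming {B : Type v} (σ : PSubst B) (ρ : Renaming) : PSubst B :=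
  fun n => σ (ρ.toFun n)

/-! ### Interpretation and subtyping -/

mutual
/-- The interpretation domain over a set `C` of constants. Elements are labelled with finite sets of
type variables. A finite relation is given by an enumeration of its pairs `(arg i, res i)`; being an
element of a type only depends on the set of these pairs. -/
inductive Dom (C : Type u) : Type u
  | const (c : C) (L : Finset TVar)
  | pair (d₁ d₂ : Dom C) (L : Finset TVar)
  | rel (n : ℕ) (arg : Fin n → Dom C) (res : Fin n → DomOmega C) (L : Finset TVar)

/-- The elements of the domain, together with the failure `Ω`. -/
inductive DomOmega (C : Type u) : Type u
  | omega
  | val (d : Dom C)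
end

/-- The interpretation of basic types as sets of constants, and the basic type of each constant. -/
structure BasicTypes (C : Type u) (B : Type v) where
  consts : B → Set C
  basic : C → B
  mem_basic : ∀ c, c ∈ consts (basic c)

section Subtyping

variable {C : Type u} {B : Type v} (𝓑 : BasicTypes C B)

mutual
/-- `Mem 𝓑 d t`: the element `d` belongs to the type `t`. -/
def Mem : Dom C → Ty B → Prop
  | .const c L => Ty.evalBool fun t =>
      match t.dest with
      | ⟨.base b, _⟩ => c ∈ 𝓑.consts b
      | ⟨.var a, _⟩ => a ∈ L
      | _ => False
  | .pair d₁ d₂ L => Ty.evalBool fun t =>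
      match t.dest with
      | ⟨.var a, _⟩ => a ∈ L
      | ⟨.prod, f⟩ => Mem d₁ (f false) ∧ Mem d₂ (f true)
      | _ => False
  | .rel _ arg res L => Ty.evalBool fun t =>
      match t.dest with
      | ⟨.var a, _⟩ => a ∈ L
      | ⟨.arrow, f⟩ => ∀ i, Mem (arg i) (f false) → MemOmega (res i) (f true)
      | _ => False

/-- Membership for the domain extended with `Ω`, which belongs to no type. -/
def MemOmega : DomOmega C → Ty B → Prop
  | .omega => fun _ => False
  | .val d => fun t => Mem d t
end

/-- Subtyping: inclusion of the interpretations. -/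
def IsSubtype (t s : Ty B) : Prop := ∀ d : Dom C, Mem 𝓑 d t → Mem 𝓑 d s

/-- Subtyping equivalence. -/
def IsEquiv (t s : Ty B) : Prop := IsSubtype 𝓑 t s ∧ IsSubtype 𝓑 s t

/-- `u` is a minimum, with respect to subtyping, of a set of types. -/
def IsMin (S : Set (Ty B)) (u : Ty B) : Prop := u ∈ S ∧ ∀ w ∈ S, IsSubtype 𝓑 u w

/-- `u` is a maximum, with respect to subtyping, of a set of types. -/
def IsMax (S : Set (Ty B)) (u : Ty B) : Prop := u ∈ S ∧ ∀ w ∈ S, IsSubtype 𝓑 w u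

/-- `u` is the domain of `t`, that is `max {u | t ≤ u → any}`. Like the operators below, it is
determined up to equivalence. -/
def IsDomain (t u : Ty B) : Prop := IsMax 𝓑 {w | IsSubtype 𝓑 t (.arrow w .any)} u

/-- `u` is the result `t ∘ s` of an application, that is `min {u | t ≤ s → u}`. -/
def IsApply (t s u : Ty B) : Prop := IsMin 𝓑 {w | IsSubtype 𝓑 t (.arrow s w)} u

/-- `u` is the first (`false`) or second (`true`) projection of `t`, that is `min {u | t ≤ u × any}`
or `min {u | t ≤ any × u}`. -/
def IsProj (i : Bool) (t u : Ty B) : Prop :=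
  IsMin 𝓑 {w | IsSubtype 𝓑 t (bif i then .prod .any w else .prod w .any)} u

/-- The finite set `S` is a principal solution of the tallying problem `t ≤ s`: its elements are
solutions, and every solution is, on the variables of the problem, an instance of one of them. -/
def IsTally (S : List (PSubst B)) (t s : Ty B) : Prop :=
  (∀ σ ∈ S, IsSubtype 𝓑 (t.inst σ) (s.inst σ)) ∧
  ∀ σ' : PSubst B, IsSubtype 𝓑 (t.inst σ') (s.inst σ') →
    ∃ σ ∈ S, ∃ σ'' : PSubst B, ∀ n ∈ t.polyVars ∪ s.polyVars,
      IsEquiv 𝓑 (σ' n) ((σ n).inst σ'')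

end Subtyping

/-! ### Expressions and canonical forms -/

/-- Expression variables: lambda variables and binding variables. -/
inductive Var : Type
  | lam (n : ℕ)
  | bind (n : ℕ)
  deriving DecidableEq

/-- Expressions of the source language, modulo renaming of bound variables: free variables are named
and bound ones are de Bruijn indices. `Expr C B n` has `n` dangling indices, so that the expressions
proper are the elements of `Expr C B 0`. In projections, `false` is the first component. -/
inductive Expr (C : Type u) (B : Type v) : ℕ → Type (max u v)
  | const {n : ℕ} (c : C) : Expr C B n
  | fvar {n : ℕ} (x : Var) : Expr C B n
  | bvar {n : ℕ} (i : Fin n) : Expr C B n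
  | lam {n : ℕ} (e : Expr C B (n + 1)) : Expr C B n
  | app {n : ℕ} (e₁ e₂ : Expr C B n) : Expr C B n
  | pair {n : ℕ} (e₁ e₂ : Expr C B n) : Expr C B n
  | proj {n : ℕ} (i : Bool) (e : Expr C B n) : Expr C B n
  | tcase {n : ℕ} (e : Expr C B n) (τ : TestTy B) (e₁ e₂ : Expr C B n) : Expr C B n

namespace Expr

variable {C : Type u} {B : Type v}

/-- Turns the free variable `x` into an index bound by an additional outermost binder. -/
def close (x : Var) : {n : ℕ} → Expr C B n → Expr C B (n + 1)
  | _, .const c => .const c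
  | n, .fvar y => if y = x then .bvar (Fin.last n) else .fvar y
  | _, .bvar i => .bvar i.castSucc
  | _, .lam e => .lam (e.close x)
  | _, .app e₁ e₂ => .app (e₁.close x) (e₂.close x)
  | _, .pair e₁ e₂ => .pair (e₁.close x) (e₂.close x)
  | _, .proj i e => .proj i (e.close x)
  | _, .tcase e τ e₁ e₂ => .tcase (e.close x) τ (e₁.close x) (e₂.close x)

/-- The expression `λ x. e`. -/
def abs (x : Var) (e : Expr C B 0) : Expr C B 0 := .lam (e.close x)

/-- Adds one dangling index (the outermost one), which does not occur. -/
def weaken : {n : ℕ} → Expr C B n → Expr C B (n + 1)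
  | _, .const c => .const c
  | _, .fvar y => .fvar y
  | _, .bvar i => .bvar i.castSucc
  | _, .lam e => .lam e.weaken
  | _, .app e₁ e₂ => .app e₁.weaken e₂.weaken
  | _, .pair e₁ e₂ => .pair e₁.weaken e₂.weaken
  | _, .proj i e => .proj i e.weaken
  | _, .tcase e τ e₁ e₂ => .tcase e.weaken τ e₁.weaken e₂.weaken

/-- An expression without dangling indices, seen as an expression below `n` binders. -/
def lift (e : Expr C B 0) : (n : ℕ) → Expr C B n
  | 0 => e
  | n + 1 => (e.lift n).weaken

/-- `subst x e' e` is the capture-avoiding substitution of `e'` for the free variable `x` in `e`. -/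
def subst (x : Var) (e' : Expr C B 0) : {n : ℕ} → Expr C B n → Expr C B n
  | _, .const c => .const c
  | n, .fvar y => if y = x then e'.lift n else .fvar y
  | _, .bvar i => .bvar i
  | _, .lam e => .lam (subst x e' e)
  | _, .app e₁ e₂ => .app (subst x e' e₁) (subst x e' e₂)
  | _, .pair e₁ e₂ => .pair (subst x e' e₁) (subst x e' e₂)
  | _, .proj i e => .proj i (subst x e' e)
  | _, .tcase e τ e₁ e₂ => .tcase (subst x e' e) τ (subst x e' e₁) (subst x e' e₂)

end Expr

mutual
/-- Atomic expressions. Lambda variables and binding variables are given by their indices. -/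
inductive Atom (C : Type u) (B : Type v) : Type (max u v)
  | const (c : C)
  | var (x : ℕ)
  | lam (x : ℕ) (κ : Form C B)
  | pair (x₁ x₂ : ℕ)
  | app (x₁ x₂ : ℕ)
  | proj (i : Bool) (x : ℕ)
  | tcase (x : ℕ) (τ : TestTy B) (x₁ x₂ : ℕ)

/-- Canonical forms: a binding variable, or `bind x = a in κ`. -/
inductive Form (C : Type u) (B : Type v) : Type (max u v)
  | var (x : ℕ)
  | bind (x : ℕ) (a : Atom C B) (κ : Form C B)
end

mutual
/-- The unwinding of an atom. -/
def Atom.unwind {C : Type u} {B : Type v} : Atom C B → Expr C B 0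
  | .const c => .const c
  | .var x => .fvar (.lam x)
  | .lam x κ => .abs (.lam x) κ.unwind
  | .pair x₁ x₂ => .pair (.fvar (.bind x₁)) (.fvar (.bind x₂))
  | .app x₁ x₂ => .app (.fvar (.bind x₁)) (.fvar (.bind x₂))
  | .proj i x => .proj i (.fvar (.bind x))
  | .tcase x τ x₁ x₂ => .tcase (.fvar (.bind x)) τ (.fvar (.bind x₁)) (.fvar (.bind x₂))

/-- The unwinding of a canonical form: bindings are inlined. -/
def Form.unwind {C : Type u} {B : Type v} : Form C B → Expr C B 0
  | .var x => .fvar (.bind x)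
  | .bind x a κ => .subst (.bind x) a.unwind κ.unwind
end

/-! ### Type environments and the declarative type system -/

/-- Type environments: partial maps from variables to types. -/
abbrev Env (B : Type v) : Type v := Var → Option (Ty B)

namespace Env

variable {B : Type v}

/-- The environment `Γ, x : t`. -/
def ext (Γ : Env B) (x : Var) (t : Ty B) : Env B := Function.update Γ x (some t)

/-- `x ∈ dom Γ`. -/
def InDom (Γ : Env B) (x : Var) : Prop := ∃ t, Γ x = some t

/-- The polymorphic type variables that occur in an environment. -/
def polyVars (Γ : Env B) : Set ℕ := {n | ∃ x t, Γ x = some t ∧ n ∈ t.polyVars}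

end Env

/-- The declarative type system: `Γ ⊢ e : t`. -/
inductive Decl {C : Type u} {B : Type v} (𝓑 : BasicTypes C B) :
    Env B → Expr C B 0 → Ty B → Prop
  | const (Γ : Env B) (c : C) : Decl 𝓑 Γ (.const c) (.base (𝓑.basic c))
  | ax (Γ : Env B) (x : Var) (t : Ty B) (hx : Γ x = some t) : Decl 𝓑 Γ (.fvar x) t
  | arrowI (Γ : Env B) (x : Var) (e : Expr C B 0) (m : MonoTy B) (t : Ty B)
      (h : Decl 𝓑 (Γ.ext x m.1) e t) : Decl 𝓑 Γ (.abs x e) (.arrow m.1 t)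
  | arrowE (Γ : Env B) (e₁ e₂ : Expr C B 0) (t₁ t₂ : Ty B)
      (h₁ : Decl 𝓑 Γ e₁ (.arrow t₁ t₂)) (h₂ : Decl 𝓑 Γ e₂ t₁) : Decl 𝓑 Γ (.app e₁ e₂) t₂
  | prodI (Γ : Env B) (e₁ e₂ : Expr C B 0) (t₁ t₂ : Ty B)
      (h₁ : Decl 𝓑 Γ e₁ t₁) (h₂ : Decl 𝓑 Γ e₂ t₂) : Decl 𝓑 Γ (.pair e₁ e₂) (.prod t₁ t₂)
  | prodE₁ (Γ : Env B) (e : Expr C B 0) (t₁ t₂ : Ty B)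
      (h : Decl 𝓑 Γ e (.prod t₁ t₂)) : Decl 𝓑 Γ (.proj false e) t₁
  | prodE₂ (Γ : Env B) (e : Expr C B 0) (t₁ t₂ : Ty B)
      (h : Decl 𝓑 Γ e (.prod t₁ t₂)) : Decl 𝓑 Γ (.proj true e) t₂
  | caseEmpty (Γ : Env B) (e e₁ e₂ : Expr C B 0) (τ : TestTy B)
      (h : Decl 𝓑 Γ e .empty) : Decl 𝓑 Γ (.tcase e τ e₁ e₂) .empty
  | case₁ (Γ : Env B) (e e₁ e₂ : Expr C B 0) (τ : TestTy B) (t₁ : Ty B)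
      (h : Decl 𝓑 Γ e τ.1) (h₁ : Decl 𝓑 Γ e₁ t₁) : Decl 𝓑 Γ (.tcase e τ e₁ e₂) t₁
  | case₂ (Γ : Env B) (e e₁ e₂ : Expr C B 0) (τ : TestTy B) (t₂ : Ty B)
      (h : Decl 𝓑 Γ e (.neg τ.1)) (h₂ : Decl 𝓑 Γ e₂ t₂) : Decl 𝓑 Γ (.tcase e τ e₁ e₂) t₂
  | unionE (Γ : Env B) (x : Var) (e e' : Expr C B 0) (s : Ty B) (m : MonoTy B) (t : Ty B)
      (h : Decl 𝓑 Γ e' s)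
      (h₁ : Decl 𝓑 (Γ.ext x (.inter s m.1)) e t)
      (h₂ : Decl 𝓑 (Γ.ext x (.inter s (.neg m.1))) e t) : Decl 𝓑 Γ (.subst x e' e) t
  | interI (Γ : Env B) (e : Expr C B 0) (t₁ t₂ : Ty B)
      (h₁ : Decl 𝓑 Γ e t₁) (h₂ : Decl 𝓑 Γ e t₂) : Decl 𝓑 Γ e (.inter t₁ t₂)
  | inst (Γ : Env B) (e : Expr C B 0) (t : Ty B) (σ : PSubst B)
      (h : Decl 𝓑 Γ e t) : Decl 𝓑 Γ e (t.inst σ)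
  | sub (Γ : Env B) (e : Expr C B 0) (t t' : Ty B)
      (h : Decl 𝓑 Γ e t) (hle : IsSubtype 𝓑 t t') : Decl 𝓑 Γ e t'

/-! ### Annotations and the algorithmic type system

Finite sets of annotations are given as finite families indexed by some `Fin n`, and finite sets of
substitutions as lists. -/

mutual
/-- Atom annotations; `nil` is the annotation `∅` of constants and variables. -/
inductive AtomAnnot (B : Type v) : Type v
  | nil
  | lam (m : MonoTy B) (k : FormAnnot B)
  | pair (ρ₁ ρ₂ : Renaming)
  | app (S₁ S₂ : List (PSubst B))
  | proj (S : List (PSubst B))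
  | caseEmpty (S : List (PSubst B))
  | caseThen (S : List (PSubst B))
  | caseElse (S : List (PSubst B))
  | inter (n : ℕ) (as : Fin n → AtomAnnot B)

/-- Form annotations. -/
inductive FormAnnot (B : Type v) : Type v
  | var (ρ : Renaming)
  | keep (a : AtomAnnot B) (n : ℕ) (ms : Fin n → MonoTy B) (ks : Fin n → FormAnnot B)
  | skip (k : FormAnnot B)
  | inter (n : ℕ) (ks : Fin n → FormAnnot B)
end

/-- The intersection of a finite family of types. -/
def Ty.iInter {B : Type v} {n : ℕ} (t : Fin n → Ty B) : Ty B := Ty.bigInter (List.ofFn t)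

/-- The union of a finite family of types. -/
def Ty.iUnion {B : Type v} {n : ℕ} (t : Fin n → Ty B) : Ty B := Ty.bigUnion (List.ofFn t)

mutual
/-- The algorithmic type system on atoms: `Γ ⊢ [a | annotation] : t`. -/
inductive AlgAtom {C : Type u} {B : Type v} (𝓑 : BasicTypes C B) :
    Env B → Atom C B → AtomAnnot B → Ty B → Prop
  | const (Γ : Env B) (c : C) : AlgAtom 𝓑 Γ (.const c) .nil (.base (𝓑.basic c))
  | ax (Γ : Env B) (x : ℕ) (t : Ty B) (hx : Γ (.lam x) = some t) : AlgAtom 𝓑 Γ (.var x) .nil t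
  | arrowI (Γ : Env B) (x : ℕ) (κ : Form C B) (m : MonoTy B) (k : FormAnnot B) (t : Ty B)
      (h : AlgForm 𝓑 (Γ.ext (.lam x) m.1) κ k t) :
      AlgAtom 𝓑 Γ (.lam x κ) (.lam m k) (.arrow m.1 t)
  | arrowE (Γ : Env B) (x₁ x₂ : ℕ) (S₁ S₂ : List (PSubst B)) (s₁ s₂ t₁ t₂ d u : Ty B)
      (hx₁ : Γ (.bind x₁) = some s₁) (hx₂ : Γ (.bind x₂) = some s₂)
      (ht₁ : t₁ = s₁.instSet S₁) (ht₂ : t₂ = s₂.instSet S₂)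
      (hfun : IsSubtype 𝓑 t₁ (.arrow .empty .any))
      (hd : IsDomain 𝓑 t₁ d) (hdom : IsSubtype 𝓑 t₂ d)
      (hu : IsApply 𝓑 t₁ t₂ u) :
      AlgAtom 𝓑 Γ (.app x₁ x₂) (.app S₁ S₂) u
  | prodI (Γ : Env B) (x₁ x₂ : ℕ) (ρ₁ ρ₂ : Renaming) (s₁ s₂ : Ty B)
      (hx₁ : Γ (.bind x₁) = some s₁) (hx₂ : Γ (.bind x₂) = some s₂) :
      AlgAtom 𝓑 Γ (.pair x₁ x₂) (.pair ρ₁ ρ₂) (.prod (s₁.inst ρ₁.toSubst) (s₂.inst ρ₂.toSubst))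
  | prodE (Γ : Env B) (i : Bool) (x : ℕ) (S : List (PSubst B)) (s t u : Ty B)
      (hx : Γ (.bind x) = some s) (ht : t = s.instSet S)
      (hprod : IsSubtype 𝓑 t (.prod .any .any)) (hu : IsProj 𝓑 i t u) :
      AlgAtom 𝓑 Γ (.proj i x) (.proj S) u
  | caseEmpty (Γ : Env B) (x : ℕ) (τ : TestTy B) (x₁ x₂ : ℕ) (S : List (PSubst B)) (s : Ty B)
      (hx : Γ (.bind x) = some s) (h : IsEquiv 𝓑 (s.instSet S) .empty) :
      AlgAtom 𝓑 Γ (.tcase x τ x₁ x₂) (.caseEmpty S) .empty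
  | case₁ (Γ : Env B) (x : ℕ) (τ : TestTy B) (x₁ x₂ : ℕ) (S : List (PSubst B)) (s t₁ : Ty B)
      (hx : Γ (.bind x) = some s) (h : IsSubtype 𝓑 (s.instSet S) τ.1)
      (hx₁ : Γ (.bind x₁) = some t₁) :
      AlgAtom 𝓑 Γ (.tcase x τ x₁ x₂) (.caseThen S) t₁
  | case₂ (Γ : Env B) (x : ℕ) (τ : TestTy B) (x₁ x₂ : ℕ) (S : List (PSubst B)) (s t₂ : Ty B)
      (hx : Γ (.bind x) = some s) (h : IsSubtype 𝓑 (s.instSet S) (.neg τ.1))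
      (hx₂ : Γ (.bind x₂) = some t₂) :
      AlgAtom 𝓑 Γ (.tcase x τ x₁ x₂) (.caseElse S) t₂
  | inter (Γ : Env B) (a : Atom C B) (n : ℕ) (as : Fin n → AtomAnnot B) (t : Fin n → Ty B)
      (hn : n ≠ 0) (h : ∀ i, AlgAtom 𝓑 Γ a (as i) (t i)) :
      AlgAtom 𝓑 Γ a (.inter n as) (Ty.iInter t)

/-- The algorithmic type system on canonical forms: `Γ ⊢ [κ | annotation] : t`. -/
inductive AlgForm {C : Type u} {B : Type v} (𝓑 : BasicTypes C B) :
    Env B → Form C B → FormAnnot B → Ty B → Prop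
  | var (Γ : Env B) (x : ℕ) (ρ : Renaming) (s : Ty B) (hx : Γ (.bind x) = some s) :
      AlgForm 𝓑 Γ (.var x) (.var ρ) (s.inst ρ.toSubst)
  | bind₁ (Γ : Env B) (x : ℕ) (a : Atom C B) (κ : Form C B) (k : FormAnnot B) (t : Ty B)
      (hx : ¬ Γ.InDom (.bind x)) (h : AlgForm 𝓑 Γ κ k t) :
      AlgForm 𝓑 Γ (.bind x a κ) (.skip k) t
  | bind₂ (Γ : Env B) (x : ℕ) (a : Atom C B) (κ : Form C B) (a' : AtomAnnot B) (n : ℕ)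
      (ms : Fin n → MonoTy B) (ks : Fin n → FormAnnot B) (s : Ty B) (t : Fin n → Ty B)
      (ha : AlgAtom 𝓑 Γ a a' s)
      (h : ∀ i, AlgForm 𝓑 (Γ.ext (.bind x) (.inter s (ms i).1)) κ (ks i) (t i))
      (hcover : IsEquiv 𝓑 (Ty.iUnion fun i => (ms i).1) .any) :
      AlgForm 𝓑 Γ (.bind x a κ) (.keep a' n ms ks) (Ty.iUnion t)
  | inter (Γ : Env B) (κ : Form C B) (n : ℕ) (ks : Fin n → FormAnnot B) (t : Fin n → Ty B)
      (hn : n ≠ 0) (h : ∀ i, AlgForm 𝓑 Γ κ (ks i) (t i)) :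
      AlgForm 𝓑 Γ κ (.inter n ks) (Ty.iInter t)
end

/-! ### Intermediate annotations and reconstruction -/

mutual
/-- Intermediate annotations of atoms. -/
inductive AtomIAnnot (B : Type v) : Type v
  | infer
  | untyp
  | typ
  | inter (n : ℕ) (todo : Fin n → AtomIAnnot B) (n' : ℕ) (done : Fin n' → AtomIAnnot B)
  | caseThen
  | caseElse
  | lam (m : MonoTy B) (b : FormIAnnot B)

/-- Intermediate annotations of canonical forms. Split annotations are families of pairs of a
monomorphic type and an intermediate annotation. -/
inductive FormIAnnot (B : Type v) : Type v
  | infer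
  | untyp
  | typ
  | inter (n : ℕ) (todo : Fin n → FormIAnnot B) (n' : ℕ) (done : Fin n' → FormIAnnot B)
  | trySkip (b : FormIAnnot B)
  | tryKeep (l : AtomIAnnot B) (b₁ b₂ : FormIAnnot B)
  | propagate (l : AtomIAnnot B) (envs : List (Env B))
      (n : ℕ) (ms : Fin n → MonoTy B) (bs : Fin n → FormIAnnot B)
      (n' : ℕ) (ms' : Fin n' → MonoTy B) (bs' : Fin n' → FormIAnnot B)
  | skip (b : FormIAnnot B)
  | keep (l : AtomIAnnot B)
      (n : ℕ) (ms : Fin n → MonoTy B) (bs : Fin n → FormIAnnot B)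
      (n' : ℕ) (ms' : Fin n' → MonoTy B) (bs' : Fin n' → FormIAnnot B)
end

/-- `ρ` renames the polymorphic variables of `t` to polymorphic variables that are fresh for `Γ`. -/
def IsFreshRenaming {B : Type v} (Γ : Env B) (t : Ty B) (ρ : Renaming) : Prop :=
  (ρ.dom : Set ℕ) = t.polyVars ∧ ∀ n ∈ ρ.dom, ρ.toFun n ∉ Γ.polyVars

/-- The variables introduced by two renamings are different. -/
def Renaming.Apart (ρ₁ ρ₂ : Renaming) : Prop :=
  ∀ n ∈ ρ₁.dom, ∀ n' ∈ ρ₂.dom, ρ₁.toFun n ≠ ρ₂.toFun n'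

/-- `α` is not introduced by the renaming. -/
def Renaming.Avoids (ρ : Renaming) (α : ℕ) : Prop := ∀ n ∈ ρ.dom, ρ.toFun n ≠ α

mutual
/-- Reconstruction for atoms: under `Γ`, an intermediate annotation of the atom is turned into an
annotation. -/
inductive ReconAtom {C : Type u} {B : Type v} (𝓑 : BasicTypes C B) :
    Env B → Atom C B → AtomIAnnot B → AtomAnnot B → Prop
  | const (Γ : Env B) (c : C) : ReconAtom 𝓑 Γ (.const c) .typ .nil
  | ax (Γ : Env B) (x : ℕ) (hx : Γ.InDom (.lam x)) : ReconAtom 𝓑 Γ (.var x) .typ .nil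
  | pair (Γ : Env B) (x₁ x₂ : ℕ) (t₁ t₂ : Ty B) (ρ₁ ρ₂ : Renaming)
      (hx₁ : Γ (.bind x₁) = some t₁) (hx₂ : Γ (.bind x₂) = some t₂)
      (hρ₁ : IsFreshRenaming Γ t₁ ρ₁) (hρ₂ : IsFreshRenaming Γ t₂ ρ₂) (hρ : ρ₁.Apart ρ₂) :
      ReconAtom 𝓑 Γ (.pair x₁ x₂) .typ (.pair ρ₁ ρ₂)
  | proj (Γ : Env B) (i : Bool) (x : ℕ) (t : Ty B) (α β : ℕ) (S : List (PSubst B))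
      (hx : Γ (.bind x) = some t)
      (hα : α ∉ Γ.polyVars) (hβ : β ∉ Γ.polyVars) (hαβ : α ≠ β)
      (hS : IsTally 𝓑 S t (.prod (.pvar α) (.pvar β))) (hne : S ≠ []) :
      ReconAtom 𝓑 Γ (.proj i x) .typ (.proj S)
  | app (Γ : Env B) (x₁ x₂ : ℕ) (t₁ t₂ : Ty B) (ρ₁ ρ₂ : Renaming) (α : ℕ) (S : List (PSubst B))
      (hx₁ : Γ (.bind x₁) = some t₁) (hx₂ : Γ (.bind x₂) = some t₂)
      (hρ₁ : IsFreshRenaming Γ t₁ ρ₁) (hρ₂ : IsFreshRenaming Γ t₂ ρ₂) (hρ : ρ₁.Apart ρ₂)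
      (hα : α ∉ Γ.polyVars) (hα₁ : ρ₁.Avoids α) (hα₂ : ρ₂.Avoids α)
      (hS : IsTally 𝓑 S (t₁.inst ρ₁.toSubst) (.arrow (t₂.inst ρ₂.toSubst) (.pvar α)))
      (hne : S ≠ []) :
      ReconAtom 𝓑 Γ (.app x₁ x₂) .typ
        (.app (S.map fun σ => σ.compRenaming ρ₁) (S.map fun σ => σ.compRenaming ρ₂))
  | caseEmpty (Γ : Env B) (x : ℕ) (τ : TestTy B) (x₁ x₂ : ℕ) (t : Ty B) (S : List (PSubst B))
      (σ : PSubst B) (hx : Γ (.bind x) = some t)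
      (hS : IsTally 𝓑 S t .empty) (hσ : σ ∈ S) :
      ReconAtom 𝓑 Γ (.tcase x τ x₁ x₂) .typ (.caseEmpty [σ])
  | case₁ (Γ : Env B) (x : ℕ) (τ : TestTy B) (x₁ x₂ : ℕ) (t : Ty B) (S : List (PSubst B))
      (σ : PSubst B) (hx : Γ (.bind x) = some t)
      (hS : IsTally 𝓑 S t τ.1) (hσ : σ ∈ S) (hx₁ : Γ.InDom (.bind x₁)) :
      ReconAtom 𝓑 Γ (.tcase x τ x₁ x₂) .typ (.caseThen [σ])
  | case₂ (Γ : Env B) (x : ℕ) (τ : TestTy B) (x₁ x₂ : ℕ) (t : Ty B) (S : List (PSubst B))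
      (σ : PSubst B) (hx : Γ (.bind x) = some t)
      (hS : IsTally 𝓑 S t (.neg τ.1)) (hσ : σ ∈ S) (hx₂ : Γ.InDom (.bind x₂)) :
      ReconAtom 𝓑 Γ (.tcase x τ x₁ x₂) .typ (.caseElse [σ])
  | lam (Γ : Env B) (x : ℕ) (κ : Form C B) (m : MonoTy B) (b : FormIAnnot B) (k : FormAnnot B)
      (h : ReconForm 𝓑 (Γ.ext (.lam x) m.1) κ b k) :
      ReconAtom 𝓑 Γ (.lam x κ) (.lam m b) (.lam m k)
  | inter (Γ : Env B) (a : Atom C B) (todo : Fin 0 → AtomIAnnot B) (n : ℕ)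
      (ls : Fin n → AtomIAnnot B) (as : Fin n → AtomAnnot B)
      (hn : n ≠ 0) (h : ∀ i, ReconAtom 𝓑 Γ a (ls i) (as i)) :
      ReconAtom 𝓑 Γ a (.inter 0 todo n ls) (.inter n as)

/-- Reconstruction for canonical forms. -/
inductive ReconForm {C : Type u} {B : Type v} (𝓑 : BasicTypes C B) :
    Env B → Form C B → FormIAnnot B → FormAnnot B → Prop
  | var (Γ : Env B) (x : ℕ) (t : Ty B) (ρ : Renaming)
      (hx : Γ (.bind x) = some t) (hρ : IsFreshRenaming Γ t ρ) :
      ReconForm 𝓑 Γ (.var x) .typ (.var ρ)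
  | bindSkip (Γ : Env B) (x : ℕ) (a : Atom C B) (κ : Form C B) (b : FormIAnnot B)
      (k : FormAnnot B) (hx : ¬ Γ.InDom (.bind x)) (h : ReconForm 𝓑 Γ κ b k) :
      ReconForm 𝓑 Γ (.bind x a κ) (.skip b) (.skip k)
  | bindKeep (Γ : Env B) (x : ℕ) (a : Atom C B) (κ : Form C B) (l : AtomIAnnot B)
      (ms₀ : Fin 0 → MonoTy B) (bs₀ : Fin 0 → FormIAnnot B)
      (n : ℕ) (ms : Fin n → MonoTy B) (bs : Fin n → FormIAnnot B)
      (a' : AtomAnnot B) (ks : Fin n → FormAnnot B) (s : Ty B)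
      (ha : ReconAtom 𝓑 Γ a l a') (hs : AlgAtom 𝓑 Γ a a' s)
      (h : ∀ i, ReconForm 𝓑 (Γ.ext (.bind x) (.inter s (ms i).1)) κ (bs i) (ks i))
      (hcover : IsEquiv 𝓑 (Ty.iUnion fun i => (ms i).1) .any) :
      ReconForm 𝓑 Γ (.bind x a κ) (.keep l 0 ms₀ bs₀ n ms bs) (.keep a' n ms ks)
  | inter (Γ : Env B) (κ : Form C B) (todo : Fin 0 → FormIAnnot B) (n : ℕ)
      (bs : Fin n → FormIAnnot B) (ks : Fin n → FormAnnot B)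
      (hn : n ≠ 0) (h : ∀ i, ReconForm 𝓑 Γ κ (bs i) (ks i)) :
      ReconForm 𝓑 Γ κ (.inter 0 todo n bs) (.inter n ks)
end

end PolyDyn

namespace PolyDyn

universe u v

/-! ### Substitution and instances -/

namespace RawTy

variable {B : Type v}

-- Soundness splits into two statements, each proved by recursion on derivations: a reconstructed
-- annotation is typable in the algorithmic system (`ReconForm.exists_algForm`,
-- `ReconAtom.exists_algAtom`), and an algorithmic derivation yields a declarative one for the
-- unwinding, with the same type (`AlgForm.decl`, `AlgAtom.decl`).
--
-- For typability, a solution of a tallying problem gives the inequality that the matching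
-- algorithmic rule demands, because `t.instSet S` lies below `t.inst σ` for every `σ ∈ S`. What
-- remains is that domains, results of applications and projections exist as types. Semantically
-- each is an evident set of domain elements. Replacing a component of a pair or of a finite
-- relation by one that belongs to the same sub-terms of `t` does not change membership in `t`, so
-- this set is saturated for the sub-terms of `t`. A regular type has finitely many sub-terms, hence
-- the set is a finite Boolean combination of them and is the interpretation of a type
-- (`exists_type_of_indist`).
--
-- For the declarative system, the atoms reduce to instantiation, intersection and subsumption, and
-- the work lies in the bindings. A kept binding is a finite sequence of binary union eliminations
-- (`Decl.union_cover`, `Decl.iUnion`). A skipped binding substitutes an arbitrary, possibly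
-- untypable expression for a variable without a type; that variable may still occur, since the
-- typing of a type-case can ignore a branch. Both rest on one substitution lemma, `Decl.ssubst`, in
-- which typed variables go to variables of smaller type and untyped variables go anywhere.

theorem subst_subst (θ θ' : TVar → RawTy B) (t : RawTy B) :
    subst θ' (subst θ t) = subst (fun a => subst θ' (θ a)) t := by
  -- Equality is added to the bisimulation because both sides coincide once a variable has been
  -- replaced.
  refine PFunctor.M.bisim (fun x y => x = y ∨ ∃ t, x = subst θ' (subst θ t) ∧
    y = subst (fun a => subst θ' (θ a)) t) ?_ _ _ (.inr ⟨t, rfl, rfl⟩)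
  rintro x y (rfl | ⟨t, rfl, rfl⟩)
  · exact ⟨_, _, _, rfl, rfl, fun _ => .inl rfl⟩
  · by_cases hv : ∃ a, t.dest.1 = TyHead.var a
    · obtain ⟨a, ha⟩ := hv
      rw [subst_var _ ha, subst_var _ ha]
      exact ⟨_, _, _, rfl, rfl, fun _ => .inl rfl⟩
    · have hd := dest_subst θ (fun a ha => hv ⟨a, ha⟩)
      have hd' := dest_subst θ' (t := subst θ t)
        (by rw [hd]; exact fun a ha => hv ⟨a, ha⟩)
      rw [hd] at hd'
      exact ⟨_, _, _, hd', dest_subst _ (fun a ha => hv ⟨a, ha⟩), fun i => .inr ⟨_, rfl, rfl⟩⟩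

/-- Needed for test types, which are ground: a solution of a tallying problem against a test type
leaves that side unchanged. -/
theorem subst_eq_self (θ : TVar → RawTy B) {t : RawTy B}
    (ht : ∀ s a, Subterm t s → s.dest.1 ≠ TyHead.var a) : subst θ t = t := by
  refine PFunctor.M.bisim (fun x y => (∀ s a, Subterm y s → s.dest.1 ≠ TyHead.var a) ∧
    x = subst θ y) ?_ _ _ ⟨ht, rfl⟩
  rintro _ y ⟨hy, rfl⟩
  exact ⟨_, _, _, dest_subst θ fun a => hy y a .refl, rfl,
    fun i => ⟨fun s a hs => hy s a (.head ⟨i, rfl⟩ hs), rfl⟩⟩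

end RawTy

namespace Ty

variable {B : Type v}

theorem raw_injective : Function.Injective (raw (B := B)) := by
  rintro ⟨t, _, _⟩ ⟨s, _, _⟩ h
  cases h
  rfl

theorem substVars_mkHead (θ : TVar → Ty B) {h : TyHead B} (hh : ∀ a, h ≠ .var a)
    (f : h.Arity → Ty B) : (mkHead h f).substVars θ = mkHead h fun i => (f i).substVars θ := by
  apply raw_injective
  have := RawTy.dest_subst (fun a => (θ a).raw) (t := (mkHead h f).raw) hh
  rw [← PFunctor.M.mk_dest (((mkHead h f).substVars θ).raw)]
  exact congrArg _ this

theorem inst_arrow (t s : Ty B) (σ : PSubst B) :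
    (arrow t s).inst σ = arrow (t.inst σ) (s.inst σ) := by
  refine (substVars_mkHead _ (by simp) _).trans (congrArg _ (funext fun i => ?_))
  cases i <;> rfl

theorem inst_prod (t s : Ty B) (σ : PSubst B) :
    (prod t s).inst σ = prod (t.inst σ) (s.inst σ) := by
  refine (substVars_mkHead _ (by simp) _).trans (congrArg _ (funext fun i => ?_))
  cases i <;> rfl

theorem inst_neg (t : Ty B) (σ : PSubst B) : (neg t).inst σ = neg (t.inst σ) :=
  substVars_mkHead _ (by simp) _

theorem inst_empty (σ : PSubst B) : (empty : Ty B).inst σ = empty :=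
  (substVars_mkHead _ (by simp) _).trans (congrArg _ (funext fun i => i.elim))

theorem inst_of_vars_eq_empty {t : Ty B} (ht : t.vars = ∅) (σ : PSubst B) : t.inst σ = t :=
  raw_injective <| RawTy.subst_eq_self _ fun s a hs h =>
    (Set.eq_empty_iff_forall_notMem.1 ht a) ⟨s, hs, h⟩

/-- Tallying for an application is run on renamed types, whereas the annotation records the composed
substitutions on the original types; this identity links the two. -/
theorem inst_rename_inst (t : Ty B) (ρ : Renaming) (σ : PSubst B) :
    (t.inst ρ.toSubst).inst σ = t.inst (σ.compRenaming ρ) := by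
  apply raw_injective
  refine (RawTy.subst_subst _ _ _).trans (congrArg (RawTy.subst · t.raw) (funext fun a => ?_))
  cases a with
  | poly n => exact RawTy.subst_var (a := .poly (ρ.toFun n)) _ rfl
  | mono n => exact RawTy.subst_var (a := .mono n) _ rfl

theorem isMono_any : (any : Ty B).IsMono := by
  refine Set.eq_empty_iff_forall_notMem.2 ?_
  rintro n ⟨s, hs, h⟩
  rcases RawTy.subterm_mk hs with rfl | ⟨i, hi⟩
  · cases h
  rcases RawTy.subterm_mk hi with rfl | ⟨i, hi⟩
  · cases h
  exact i.elim

/-! ### Evaluation of Boolean combinations -/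

theorem evalBool_union (p : Ty B → Prop) (t s : Ty B) :
    evalBool p (union t s) ↔ evalBool p t ∨ evalBool p s := by
  rw [evalBool]; rfl

theorem evalBool_neg (p : Ty B → Prop) (t : Ty B) : evalBool p (neg t) ↔ ¬ evalBool p t := by
  rw [evalBool]; rfl

theorem evalBool_empty (p : Ty B → Prop) : ¬ evalBool p empty := by
  rw [evalBool]; exact id

theorem evalBool_arrow (p : Ty B → Prop) (t s : Ty B) :
    evalBool p (arrow t s) ↔ p (arrow t s) := by
  rw [evalBool]; rfl

theorem evalBool_prod (p : Ty B → Prop) (t s : Ty B) :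
    evalBool p (prod t s) ↔ p (prod t s) := by
  rw [evalBool]; rfl

theorem subterm_of_dest {t : Ty B} {h : TyHead B} {f : h.Arity → Ty B} (e : t.dest = ⟨h, f⟩)
    (i : h.Arity) : t.raw.Subterm (f i).raw := by
  unfold dest at e
  cases e
  exact .single ⟨i, rfl⟩

/-- The evaluation descends only through unions and negations, which is well founded by
contractivity, and every type at which it consults the predicate is a sub-term of `t`. -/
theorem evalBool_congr {p q : Ty B → Prop} (t : Ty B)
    (h : ∀ s : Ty B, t.raw.Subterm s.raw → (p s ↔ q s)) : evalBool p t ↔ evalBool q t := by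
  induction t using wf_boolLT.induction with
  | _ t ih =>
    rw [evalBool, evalBool]
    split
    · rename_i f e
      exact or_congr
        (ih _ (boolLT_of_dest e (by simp) (by simp) _)
          fun s hs => h s ((subterm_of_dest e false).trans hs))
        (ih _ (boolLT_of_dest e (by simp) (by simp) _)
          fun s hs => h s ((subterm_of_dest e true).trans hs))
    · rename_i f e
      exact not_congr (ih _ (boolLT_of_dest e (by simp) (by simp) _)
        fun s hs => h s ((subterm_of_dest e ()).trans hs))
    · rfl
    · exact h t .refl

end Ty

/-! ### Membership -/

section Subtyping

variable {C : Type u} {B : Type v} (𝓑 : BasicTypes C B)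

@[simp]
theorem mem_union (d : Dom C) (t s : Ty B) : Mem 𝓑 d (.union t s) ↔ Mem 𝓑 d t ∨ Mem 𝓑 d s := by
  cases d <;> simp only [Mem, Ty.evalBool_union]

@[simp]
theorem mem_neg (d : Dom C) (t : Ty B) : Mem 𝓑 d (.neg t) ↔ ¬ Mem 𝓑 d t := by
  cases d <;> simp only [Mem, Ty.evalBool_neg]

@[simp]
theorem not_mem_empty (d : Dom C) : ¬ Mem 𝓑 d .empty := by
  cases d <;> simp only [Mem, Ty.evalBool_empty, not_false_eq_true]

@[simp]
theorem mem_any (d : Dom C) : Mem 𝓑 d .any := by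
  simp [Ty.any]

@[simp]
theorem mem_inter (d : Dom C) (t s : Ty B) : Mem 𝓑 d (.inter t s) ↔ Mem 𝓑 d t ∧ Mem 𝓑 d s := by
  simp [Ty.inter]

theorem mem_bigUnion (d : Dom C) (l : List (Ty B)) :
    Mem 𝓑 d (.bigUnion l) ↔ ∃ t ∈ l, Mem 𝓑 d t := by
  induction l with
  | nil => simp [Ty.bigUnion]
  | cons t l ih =>
    simp only [Ty.bigUnion, List.foldr_cons, mem_union, List.exists_mem_cons_iff] at ih ⊢
    rw [ih]

theorem mem_bigInter (d : Dom C) (l : List (Ty B)) :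
    Mem 𝓑 d (.bigInter l) ↔ ∀ t ∈ l, Mem 𝓑 d t := by
  induction l with
  | nil => simp [Ty.bigInter]
  | cons t l ih =>
    simp only [Ty.bigInter, List.foldr_cons, mem_inter, List.forall_mem_cons] at ih ⊢
    rw [ih]

theorem mem_instSet (d : Dom C) (t : Ty B) (S : List (PSubst B)) :
    Mem 𝓑 d (t.instSet S) ↔ ∀ σ ∈ S, Mem 𝓑 d (t.inst σ) := by
  simp [Ty.instSet, mem_bigInter]

theorem mem_rel_arrow (n : ℕ) (arg : Fin n → Dom C) (res : Fin n → DomOmega C)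
    (L : Finset TVar) (t s : Ty B) :
    Mem 𝓑 (.rel n arg res L) (.arrow t s) ↔
      ∀ i, Mem 𝓑 (arg i) t → MemOmega 𝓑 (res i) s := by
  simp only [Mem, Ty.evalBool_arrow]
  rfl

theorem exists_rel_of_mem_arrow {d : Dom C} {t s : Ty B} (h : Mem 𝓑 d (.arrow t s)) :
    ∃ n arg res L, d = .rel n arg res L := by
  cases d with
  | rel n arg res L => exact ⟨n, arg, res, L, rfl⟩
  | _ => simp only [Mem, Ty.evalBool_arrow] at h; exact h.elim

theorem mem_pair_prod (d₁ d₂ : Dom C) (L : Finset TVar) (t s : Ty B) :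
    Mem 𝓑 (.pair d₁ d₂ L) (.prod t s) ↔ Mem 𝓑 d₁ t ∧ Mem 𝓑 d₂ s := by
  simp only [Mem, Ty.evalBool_prod]
  rfl

theorem exists_pair_of_mem_prod {d : Dom C} {t s : Ty B} (h : Mem 𝓑 d (.prod t s)) :
    ∃ d₁ d₂ L, d = .pair d₁ d₂ L := by
  cases d with
  | pair d₁ d₂ L => exact ⟨d₁, d₂, L, rfl⟩
  | _ => simp only [Mem, Ty.evalBool_prod] at h; exact h.elim

-- Subtyping as a preorder, and the variance of arrows and products.

variable {𝓑}

theorem memOmega_mono {t s : Ty B} (h : IsSubtype 𝓑 t s) {d : DomOmega C}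
    (hd : MemOmega 𝓑 d t) : MemOmega 𝓑 d s := by
  cases d with
  | omega => simp only [MemOmega] at hd
  | val d => simp only [MemOmega] at hd ⊢; exact h d hd

theorem IsSubtype.trans {t s r : Ty B} (h : IsSubtype 𝓑 t s) (h' : IsSubtype 𝓑 s r) :
    IsSubtype 𝓑 t r := fun d hd => h' d (h d hd)

theorem isSubtype_any (t : Ty B) : IsSubtype 𝓑 t .any := fun d _ => mem_any 𝓑 d

theorem empty_isSubtype (t : Ty B) : IsSubtype 𝓑 .empty t :=
  fun d h => (not_mem_empty 𝓑 d h).elim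

theorem IsSubtype.arrow {t t' s s' : Ty B} (ht : IsSubtype 𝓑 t' t) (hs : IsSubtype 𝓑 s s') :
    IsSubtype 𝓑 (.arrow t s) (.arrow t' s') := by
  intro d hd
  obtain ⟨n, arg, res, L, rfl⟩ := exists_rel_of_mem_arrow 𝓑 hd
  rw [mem_rel_arrow] at hd ⊢
  exact fun i hi => memOmega_mono hs (hd i (ht _ hi))

theorem IsSubtype.prod {t t' s s' : Ty B} (ht : IsSubtype 𝓑 t t') (hs : IsSubtype 𝓑 s s') :
    IsSubtype 𝓑 (.prod t s) (.prod t' s') := by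
  intro d hd
  obtain ⟨d₁, d₂, L, rfl⟩ := exists_pair_of_mem_prod 𝓑 hd
  rw [mem_pair_prod] at hd ⊢
  exact ⟨ht _ hd.1, hs _ hd.2⟩

theorem instSet_isSubtype (t : Ty B) {S : List (PSubst B)} {σ : PSubst B} (hσ : σ ∈ S) :
    IsSubtype 𝓑 (t.instSet S) (t.inst σ) := fun d hd => (mem_instSet 𝓑 d t S).1 hd σ hσ

/-! ### Existence of domains, results of applications and projections -/

variable (𝓑) in
/-- Two elements of the domain are indistinguishable by the sub-terms of `t`. -/
def Indist (t : Ty B) (d d' : Dom C) : Prop :=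
  ∀ s : Ty B, t.raw.Subterm s.raw → (Mem 𝓑 d s ↔ Mem 𝓑 d' s)

theorem Indist.refl (t : Ty B) (d : Dom C) : Indist 𝓑 t d d := fun _ _ => .rfl

theorem Indist.symm {t : Ty B} {d d' : Dom C} (h : Indist 𝓑 t d d') : Indist 𝓑 t d' d :=
  fun s hs => (h s hs).symm

/-- Disjunctive normal form, by induction on `l`: a set that respects `l` is split along `s`, and
each half agrees, inside `s` or inside its complement, with a set that respects the shorter list.
With no type left to distinguish elements, the set is everything or nothing. -/
theorem exists_type_of_saturated (l : List (Ty B)) (W : Dom C → Prop)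
    (hW : ∀ d d', (∀ s ∈ l, Mem 𝓑 d s ↔ Mem 𝓑 d' s) → W d → W d') :
    ∃ u : Ty B, ∀ d, Mem 𝓑 d u ↔ W d := by
  induction l generalizing W with
  | nil =>
    by_cases h : ∃ d, W d
    · obtain ⟨d, hd⟩ := h
      exact ⟨.any, fun d' => iff_of_true (mem_any 𝓑 d') (hW d d' (by simp) hd)⟩
    · exact ⟨.empty, fun d' => iff_of_false (not_mem_empty 𝓑 d') fun hd => h ⟨d', hd⟩⟩
  | cons s l ih =>
    -- The part of `W` inside `P` need not respect `l` alone, so its saturation is used instead.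
    have key : ∀ P : Dom C → Prop, ∃ u : Ty B, ∀ d, Mem 𝓑 d u ↔
        ∃ d', P d' ∧ W d' ∧ ∀ r ∈ l, Mem 𝓑 d' r ↔ Mem 𝓑 d r := by
      refine fun P => ih _ ?_
      rintro d d' h ⟨d'', hP, hd'', h'⟩
      exact ⟨d'', hP, hd'', fun r hr => (h' r hr).trans (h r hr)⟩
    obtain ⟨u₁, hu₁⟩ := key fun d => Mem 𝓑 d s
    obtain ⟨u₀, hu₀⟩ := key fun d => ¬ Mem 𝓑 d s
    refine ⟨.union (.inter s u₁) (.inter (.neg s) u₀), fun d => ?_⟩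
    simp only [mem_union, mem_inter, mem_neg, hu₁, hu₀]
    constructor
    · rintro (⟨hd, d', hs, hW', h⟩ | ⟨hd, d', hs, hW', h⟩) <;>
        exact hW d' d (List.forall_mem_cons.2 ⟨by tauto, h⟩) hW'
    · intro hd
      by_cases hs : Mem 𝓑 d s
      · exact .inl ⟨hs, d, hs, hd, fun _ _ => .rfl⟩
      · exact .inr ⟨hs, d, hs, hd, fun _ _ => .rfl⟩

/-- This is where regularity enters: the finitely many sub-terms of `t` serve as the generators of
the Boolean combination. -/
theorem exists_type_of_indist (t : Ty B) (W : Dom C → Prop)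
    (hW : ∀ d d', Indist 𝓑 t d d' → W d → W d') : ∃ u : Ty B, ∀ d, Mem 𝓑 d u ↔ W d := by
  have hfin : {s : Ty B | t.raw.Subterm s.raw}.Finite :=
    t.regular.preimage Ty.raw_injective.injOn
  refine exists_type_of_saturated hfin.toFinset.toList W fun d d' h => hW d d' fun s hs => ?_
  exact h s (by simpa using hs)

/-- The only products that the evaluation of `t` meets are sub-terms of `t`, so their components are
among the types that indistinguishable elements agree on. -/
theorem Indist.mem_pair {t : Ty B} {d₁ d₂ d₁' d₂' : Dom C} (h₁ : Indist 𝓑 t d₁ d₁')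
    (h₂ : Indist 𝓑 t d₂ d₂') {L : Finset TVar} (h : Mem 𝓑 (.pair d₁ d₂ L) t) :
    Mem 𝓑 (.pair d₁' d₂' L) t := by
  simp only [Mem] at h ⊢
  refine (Ty.evalBool_congr t fun s hs => ?_).1 h
  split
  · rfl
  · rename_i f e
    exact and_congr (h₁ _ (hs.trans (Ty.subterm_of_dest e false)))
      (h₂ _ (hs.trans (Ty.subterm_of_dest e true)))
  · rfl

/-- The analogue for relations. Agreement of the results is stated with `MemOmega`, as a result may
be the failure `Ω`. -/
theorem mem_rel_of_indist {t : Ty B} {n : ℕ} {arg arg' : Fin n → Dom C}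
    {res res' : Fin n → DomOmega C} (h₁ : ∀ i, Indist 𝓑 t (arg i) (arg' i))
    (h₂ : ∀ i (s : Ty B), t.raw.Subterm s.raw →
      (MemOmega 𝓑 (res i) s ↔ MemOmega 𝓑 (res' i) s))
    {L : Finset TVar} (h : Mem 𝓑 (.rel n arg res L) t) : Mem 𝓑 (.rel n arg' res' L) t := by
  simp only [Mem] at h ⊢
  refine (Ty.evalBool_congr t fun s hs => ?_).1 h
  split
  · rfl
  · rename_i f e
    exact forall_congr' fun i => imp_congr (h₁ i _ (hs.trans (Ty.subterm_of_dest e false)))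
      (h₂ i _ (hs.trans (Ty.subterm_of_dest e true)))
  · rfl

theorem exists_isDomain {t : Ty B} (ht : IsSubtype 𝓑 t (.arrow .empty .any)) :
    ∃ u, IsDomain 𝓑 t u := by
  -- The domain consists of the arguments that no relation in `t` sends to `Ω`. For saturation, an
  -- offending pair with argument `d'` becomes one with argument `d`, and the relation stays in `t`.
  obtain ⟨u, hu⟩ := exists_type_of_indist (𝓑 := 𝓑) t
    (fun d => ∀ n arg res L i, Mem 𝓑 (.rel n arg res L) t → arg i = d → res i ≠ .omega) (by
      rintro d d' h hd n arg res L i hmem rfl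
      refine hd n (Function.update arg i d) res L i ?_ (by simp)
      refine mem_rel_of_indist (fun j => ?_) (fun _ _ _ => .rfl) hmem
      by_cases hj : j = i
      · subst hj; simpa using h.symm
      · simpa [hj] using Indist.refl t _)
  refine ⟨u, fun d hd => ?_, fun w hw d hd => (hu d).2 ?_⟩
  · obtain ⟨n, arg, res, L, rfl⟩ := exists_rel_of_mem_arrow 𝓑 (ht d hd)
    refine (mem_rel_arrow ..).2 fun i hi => ?_
    have := (hu _).1 hi n arg res L i hd rfl
    cases hres : res i with
    | omega => exact (this hres).elim
    | val d => simp only [MemOmega, mem_any]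
  -- Maximality: if `t` is below `w → any`, a pair with argument in `w` cannot have result `Ω`,
  -- which belongs to no type.
  · rintro n arg res L i hmem rfl hres
    have := (mem_rel_arrow ..).1 (hw _ hmem) i hd
    simp only [hres, MemOmega] at this

theorem exists_isApply {t s : Ty B} (ht : IsSubtype 𝓑 t (.arrow s .any)) :
    ∃ u, IsApply 𝓑 t s u := by
  -- The result type consists of the proper results that relations in `t` give to arguments in `s`.
  -- Only the result is exchanged in the saturation argument, so the sub-terms of `s` play no role.
  obtain ⟨u, hu⟩ := exists_type_of_indist (𝓑 := 𝓑) t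
    (fun d => ∃ n arg res L i, Mem 𝓑 (.rel n arg res L) t ∧ Mem 𝓑 (arg i) s ∧ res i = .val d) (by
      rintro d d' h ⟨n, arg, res, L, i, hmem, harg, hres⟩
      refine ⟨n, arg, Function.update res i (.val d'), L, i, ?_, harg, by simp⟩
      refine mem_rel_of_indist (fun j => Indist.refl t _) (fun j r hr => ?_) hmem
      by_cases hj : j = i
      · subst hj
        simpa only [Function.update_self, hres, MemOmega] using h r hr
      · simp [hj])
  refine ⟨u, fun d hd => ?_, fun w hw d hd => ?_⟩
  · obtain ⟨n, arg, res, L, rfl⟩ := exists_rel_of_mem_arrow 𝓑 (ht d hd)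
    refine (mem_rel_arrow ..).2 fun i hi => ?_
    have := (mem_rel_arrow ..).1 (ht _ hd) i hi
    cases hres : res i with
    | omega => simp only [hres, MemOmega] at this
    | val d => simpa only [MemOmega] using (hu d).2 ⟨n, arg, res, L, i, hd, hi, hres⟩
  · obtain ⟨n, arg, res, L, i, hmem, harg, hres⟩ := (hu d).1 hd
    have := (mem_rel_arrow ..).1 (hw _ hmem) i harg
    simpa only [hres, MemOmega] using this

theorem exists_isProj (i : Bool) {t : Ty B} (ht : IsSubtype 𝓑 t (.prod .any .any)) :
    ∃ u, IsProj 𝓑 i t u := by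
  cases i with
  | false =>
    -- The set-theoretic projection of `t`; exchanging the retained component of a pair proves
    -- saturation.
    obtain ⟨u, hu⟩ := exists_type_of_indist (𝓑 := 𝓑) t
      (fun d => ∃ d₂ L, Mem 𝓑 (.pair d d₂ L) t)
      (fun d d' h ⟨d₂, L, hd⟩ => ⟨d₂, L, h.mem_pair (.refl t _) hd⟩)
    refine ⟨u, fun d hd => ?_, fun w hw d hd => ?_⟩
    · obtain ⟨d₁, d₂, L, rfl⟩ := exists_pair_of_mem_prod 𝓑 (ht d hd)
      exact (mem_pair_prod ..).2 ⟨(hu _).2 ⟨d₂, L, hd⟩, mem_any ..⟩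
    · obtain ⟨d₂, L, h⟩ := (hu d).1 hd
      exact ((mem_pair_prod ..).1 (hw _ h)).1
  | true =>
    obtain ⟨u, hu⟩ := exists_type_of_indist (𝓑 := 𝓑) t
      (fun d => ∃ d₁ L, Mem 𝓑 (.pair d₁ d L) t)
      (fun d d' h ⟨d₁, L, hd⟩ => ⟨d₁, L, Indist.mem_pair (.refl t _) h hd⟩)
    refine ⟨u, fun d hd => ?_, fun w hw d hd => ?_⟩
    · obtain ⟨d₁, d₂, L, rfl⟩ := exists_pair_of_mem_prod 𝓑 (ht d hd)
      exact (mem_pair_prod ..).2 ⟨mem_any .., (hu _).2 ⟨d₁, L, hd⟩⟩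
    · obtain ⟨d₁, L, h⟩ := (hu d).1 hd
      exact ((mem_pair_prod ..).1 (hw _ h)).2

end Subtyping

/-! ### Reconstructed annotations are typable -/

section Reconstruction

variable {C : Type u} {B : Type v} {𝓑 : BasicTypes C B}

mutual
theorem ReconAtom.exists_algAtom {Γ : Env B} {a : Atom C B} {l : AtomIAnnot B}
    {k : AtomAnnot B} : ReconAtom 𝓑 Γ a l k → ∃ t, AlgAtom 𝓑 Γ a k t
  | .const Γ c => ⟨_, .const Γ c⟩
  | .ax Γ x ⟨t, hx⟩ => ⟨t, .ax Γ x t hx⟩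
  | .pair Γ x₁ x₂ t₁ t₂ ρ₁ ρ₂ hx₁ hx₂ _ _ _ => ⟨_, .prodI Γ x₁ x₂ ρ₁ ρ₂ t₁ t₂ hx₁ hx₂⟩
  | .proj Γ i x t α β S hx _ _ _ hS hne => by
    obtain ⟨σ, hσ⟩ := List.exists_mem_of_ne_nil S hne
    have hprod : IsSubtype 𝓑 (t.instSet S) (.prod .any .any) := by
      have := hS.1 σ hσ
      rw [Ty.inst_prod] at this
      exact (instSet_isSubtype t hσ).trans
        (this.trans (.prod (isSubtype_any _) (isSubtype_any _)))
    obtain ⟨u, hu⟩ := exists_isProj i hprod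
    exact ⟨u, .prodE Γ i x S t _ u hx rfl hprod hu⟩
  | .app Γ x₁ x₂ t₁ t₂ ρ₁ ρ₂ α S hx₁ hx₂ _ _ _ _ _ _ hS hne => by
    obtain ⟨σ, hσ⟩ := List.exists_mem_of_ne_nil S hne
    have happ : IsSubtype 𝓑 (t₁.instSet (S.map fun σ => σ.compRenaming ρ₁))
        (.arrow (t₂.instSet (S.map fun σ => σ.compRenaming ρ₂)) .any) := by
      have := hS.1 σ hσ
      rw [Ty.inst_arrow, Ty.inst_rename_inst, Ty.inst_rename_inst] at this
      exact (instSet_isSubtype t₁ (List.mem_map_of_mem hσ)).trans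
        (this.trans (.arrow (instSet_isSubtype t₂ (List.mem_map_of_mem hσ)) (isSubtype_any _)))
    have hfun := happ.trans (.arrow (empty_isSubtype _) (isSubtype_any _))
    obtain ⟨d, hd⟩ := exists_isDomain hfun
    obtain ⟨u, hu⟩ := exists_isApply happ
    -- The inequality `happ` puts the argument type among the candidates for the domain, so
    -- maximality of `d` gives the domain condition.
    exact ⟨u, .arrowE Γ x₁ x₂ _ _ t₁ t₂ _ _ d u hx₁ hx₂ rfl rfl hfun hd (hd.2 _ happ) hu⟩
  | .caseEmpty Γ x τ x₁ x₂ t S σ hx hS hσ => by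
    refine ⟨_, .caseEmpty Γ x τ x₁ x₂ [σ] t hx ⟨?_, empty_isSubtype _⟩⟩
    have := hS.1 σ hσ
    rw [Ty.inst_empty] at this
    exact (instSet_isSubtype t (by simp)).trans this
  | .case₁ Γ x τ x₁ x₂ t S σ hx hS hσ ⟨t₁, hx₁⟩ => by
    refine ⟨_, .case₁ Γ x τ x₁ x₂ [σ] t t₁ hx ?_ hx₁⟩
    have := hS.1 σ hσ
    rw [Ty.inst_of_vars_eq_empty τ.2.1] at this
    exact (instSet_isSubtype t (by simp)).trans this
  | .case₂ Γ x τ x₁ x₂ t S σ hx hS hσ ⟨t₂, hx₂⟩ => by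
    refine ⟨_, .case₂ Γ x τ x₁ x₂ [σ] t t₂ hx ?_ hx₂⟩
    have := hS.1 σ hσ
    rw [Ty.inst_neg, Ty.inst_of_vars_eq_empty τ.2.1] at this
    exact (instSet_isSubtype t (by simp)).trans this
  | .lam Γ x κ m _ k h =>
    let ⟨t, ht⟩ := h.exists_algForm
    ⟨_, .arrowI Γ x κ m k t ht⟩
  | .inter Γ a _ n _ as hn h => by
    have := fun i => (h i).exists_algAtom
    choose t ht using this
    exact ⟨_, .inter Γ a n as t hn ht⟩

theorem ReconForm.exists_algForm {Γ : Env B} {κ : Form C B} {b : FormIAnnot B}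
    {k : FormAnnot B} : ReconForm 𝓑 Γ κ b k → ∃ t, AlgForm 𝓑 Γ κ k t
  | .var Γ x t ρ hx _ => ⟨_, .var Γ x ρ t hx⟩
  | .bindSkip Γ x a κ _ k hx h =>
    let ⟨t, ht⟩ := h.exists_algForm
    ⟨t, .bind₁ Γ x a κ k t hx ht⟩
  -- The algorithmic typing `hs` stored in the rule is used, not one rebuilt for the atom: results
  -- of applications and projections are unique only up to equivalence, and the continuations are
  -- reconstructed under this particular `s`.
  | .bindKeep Γ x a κ _ _ _ n ms _ a' ks s _ hs h hcover => by
    have := fun i => (h i).exists_algForm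
    choose t ht using this
    exact ⟨_, .bind₂ Γ x a κ a' n ms ks s t hs ht hcover⟩
  | .inter Γ κ _ n _ ks hn h => by
    have := fun i => (h i).exists_algForm
    choose t ht using this
    exact ⟨_, .inter Γ κ n ks t hn ht⟩
end

end Reconstruction

/-! ### Free variables and simultaneous substitution -/

namespace Expr

variable {C : Type u} {B : Type v}

/-- The free variables of an expression. -/
def fv : {n : ℕ} → Expr C B n → Finset Var
  | _, .const _ => ∅
  | _, .fvar y => {y}
  | _, .bvar _ => ∅
  | _, .lam e => e.fv
  | _, .app e₁ e₂ => e₁.fv ∪ e₂.fv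
  | _, .pair e₁ e₂ => e₁.fv ∪ e₂.fv
  | _, .proj _ e => e.fv
  | _, .tcase e _ e₁ e₂ => e.fv ∪ (e₁.fv ∪ e₂.fv)

/-- Simultaneous capture-avoiding substitution for all free variables. -/
def ssubst (θ : Var → Expr C B 0) : {n : ℕ} → Expr C B n → Expr C B n
  | _, .const c => .const c
  | n, .fvar y => (θ y).lift n
  | _, .bvar i => .bvar i
  | _, .lam e => .lam (ssubst θ e)
  | _, .app e₁ e₂ => .app (ssubst θ e₁) (ssubst θ e₂)
  | _, .pair e₁ e₂ => .pair (ssubst θ e₁) (ssubst θ e₂)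
  | _, .proj i e => .proj i (ssubst θ e)
  | _, .tcase e τ e₁ e₂ => .tcase (ssubst θ e) τ (ssubst θ e₁) (ssubst θ e₂)

theorem lift_fvar (y : Var) (n : ℕ) : (fvar y : Expr C B 0).lift n = .fvar y := by
  induction n with
  | zero => rfl
  | succ n ih => simp [lift, ih, weaken]

theorem fv_weaken {n : ℕ} (e : Expr C B n) : e.weaken.fv = e.fv := by
  induction e <;> simp_all [weaken, fv]

theorem fv_lift (e : Expr C B 0) (n : ℕ) : (e.lift n).fv = e.fv := by
  induction n with
  | zero => rfl
  | succ n ih => rw [lift, fv_weaken, ih]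

theorem fv_close (x : Var) {n : ℕ} (e : Expr C B n) : (e.close x).fv = e.fv.erase x := by
  induction e with
  | fvar y =>
    by_cases h : y = x
    · subst h; simp [close, fv]
    · simp [close, fv, h, Ne.symm h]
  | _ => simp_all [close, fv, Finset.erase_union_distrib]

theorem close_of_notMem_fv {x : Var} {n : ℕ} {e : Expr C B n} (h : x ∉ e.fv) :
    e.close x = e.weaken := by
  induction e with
  | fvar y =>
    have hy : y ≠ x := by rintro rfl; simp [fv] at h
    simp [close, weaken, hy]
  | _ => simp_all [close, weaken, fv]

theorem subst_of_notMem_fv {x : Var} (e' : Expr C B 0) {n : ℕ} {e : Expr C B n}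
    (h : x ∉ e.fv) : subst x e' e = e := by
  induction e with
  | fvar y =>
    have hy : y ≠ x := by rintro rfl; simp [fv] at h
    simp [subst, hy]
  | _ => simp_all [subst, fv]

theorem subst_fvar_self (x : Var) {n : ℕ} (e : Expr C B n) : subst x (.fvar x) e = e := by
  induction e with
  | fvar y =>
    by_cases h : y = x
    · subst h; simp [subst, lift_fvar]
    · simp [subst, h]
  | _ => simp_all [subst]

theorem ssubst_fvar {n : ℕ} (e : Expr C B n) : ssubst .fvar e = e := by
  induction e <;> simp_all [ssubst, lift_fvar]

theorem ssubst_update_fvar (x : Var) (e' : Expr C B 0) {n : ℕ} (e : Expr C B n) :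
    ssubst (Function.update .fvar x e') e = subst x e' e := by
  induction e with
  | fvar y =>
    by_cases h : y = x
    · subst h; simp [ssubst, subst]
    · simp [ssubst, subst, h, lift_fvar]
  | _ => simp_all [ssubst, subst]

theorem mem_fv_subst_of_ne {x y : Var} (e' : Expr C B 0) {n : ℕ} {e : Expr C B n}
    (hy : y ∈ e.fv) (h : y ≠ x) : y ∈ (subst x e' e).fv := by
  induction e with
  | fvar z =>
    obtain rfl : y = z := by simpa [fv] using hy
    simp [subst, h, fv]
  | _ => simp_all [subst, fv] <;> tauto

theorem mem_fv_subst {x y : Var} {e' : Expr C B 0} {n : ℕ} {e : Expr C B n}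
    (hx : x ∈ e.fv) (hy : y ∈ e'.fv) : y ∈ (subst x e' e).fv := by
  induction e with
  | fvar z =>
    obtain rfl : x = z := by simpa [fv] using hx
    simpa [subst, fv_lift] using hy
  | _ => simp_all [subst, fv] <;> tauto

theorem ssubst_weaken (θ : Var → Expr C B 0) {n : ℕ} (e : Expr C B n) :
    ssubst θ e.weaken = (ssubst θ e).weaken := by
  induction e <;> simp_all [ssubst, weaken, lift]

theorem ssubst_lift (θ : Var → Expr C B 0) (e : Expr C B 0) (n : ℕ) :
    ssubst θ (e.lift n) = (ssubst θ e).lift n := by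
  induction n with
  | zero => rfl
  | succ n ih => rw [lift, ssubst_weaken, ih, lift]

/-- Freshness of `z` says that binding `z` captures nothing in the images of the other variables, so
the bound `x` can be renamed to `z` before substituting. -/
theorem ssubst_close (θ : Var → Expr C B 0) (x z : Var) {n : ℕ} (e : Expr C B n)
    (hz : ∀ y ∈ e.fv, y ≠ x → z ∉ (θ y).fv) :
    ssubst θ (e.close x) = (ssubst (Function.update θ x (.fvar z)) e).close z := by
  induction e with
  | @fvar n y =>
    by_cases h : y = x
    · subst h; simp [ssubst, close, lift_fvar]
    · have := hz y (by simp [fv]) h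
      rw [← fv_lift _ n] at this
      simp [ssubst, close, h, close_of_notMem_fv this, lift]
  | _ => simp_all [ssubst, close, fv]

theorem ssubst_abs (θ : Var → Expr C B 0) (x z : Var) (e : Expr C B 0)
    (hz : ∀ y ∈ e.fv, y ≠ x → z ∉ (θ y).fv) :
    ssubst θ (abs x e) = abs z (ssubst (Function.update θ x (.fvar z)) e) := by
  rw [abs, ssubst, ssubst_close θ x z e hz, abs]

/-- Brings the result of a substitution back into the shape `e{e'/z}` that union elimination
concludes; as for abstractions, `x` is first renamed to a fresh `z`. -/
theorem ssubst_subst (θ : Var → Expr C B 0) (x z : Var) (e' : Expr C B 0) {n : ℕ}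
    (e : Expr C B n) (hz : ∀ y ∈ e.fv, y ≠ x → z ∉ (θ y).fv) :
    ssubst θ (subst x e' e) =
      subst z (ssubst θ e') (ssubst (Function.update θ x (.fvar z)) e) := by
  induction e with
  | @fvar n y =>
    by_cases h : y = x
    · subst h; simp [ssubst, subst, lift_fvar, ssubst_lift]
    · have := hz y (by simp [fv]) h
      rw [← fv_lift _ n] at this
      simp [ssubst, subst, h, subst_of_notMem_fv _ this]
  | _ => simp_all [ssubst, subst, fv]

/-- Only finitely many images have to be avoided, although `θ` acts on infinitely many variables. -/
theorem exists_fresh (s : Finset Var) (θ : Var → Expr C B 0) :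
    ∃ z, ∀ y ∈ s, z ∉ (θ y).fv := by
  have : Infinite Var := Infinite.of_injective Var.lam fun _ _ h => Var.lam.inj h
  obtain ⟨z, hz⟩ := Infinite.exists_notMem_finset (s.biUnion fun y => (θ y).fv)
  exact ⟨z, fun y hy h => hz (Finset.mem_biUnion.2 ⟨y, hy, h⟩)⟩

end Expr

/-! ### Structural properties of the declarative system -/

section Declarative

variable {C : Type u} {B : Type v} {𝓑 : BasicTypes C B}

variable (𝓑) in
/-- The substitution `θ` maps the variables of `s` that are typed by `Γ` to variables to which `Δ`
gives a smaller type. -/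
def EnvRefines (s : Finset Var) (Γ Δ : Env B) (θ : Var → Expr C B 0) : Prop :=
  ∀ y ∈ s, ∀ t, Γ y = some t → ∃ z t', θ y = .fvar z ∧ Δ z = some t' ∧ IsSubtype 𝓑 t' t

theorem EnvRefines.mono {s s' : Finset Var} {Γ Δ : Env B} {θ : Var → Expr C B 0}
    (h : EnvRefines 𝓑 s Γ Δ θ) (hs : s' ⊆ s) : EnvRefines 𝓑 s' Γ Δ θ :=
  fun y hy => h y (hs hy)

/-- The condition on `z` ensures that its new entry in `Δ` does not shadow a variable that `θ`
already uses as an image. -/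
theorem EnvRefines.ext {s s' : Finset Var} {Γ Δ : Env B} {θ : Var → Expr C B 0}
    (h : EnvRefines 𝓑 s Γ Δ θ) {x z : Var} (hs : s' ⊆ insert x s)
    (hz : ∀ y ∈ s', y ≠ x → z ∉ (θ y).fv) (t : Ty B) :
    EnvRefines 𝓑 s' (Γ.ext x t) (Δ.ext z t) (Function.update θ x (.fvar z)) := by
  intro y hy r hr
  by_cases hyx : y = x
  · subst hyx
    obtain rfl : t = r := by simpa [Env.ext] using hr
    exact ⟨z, t, by simp, by simp [Env.ext], fun _ => id⟩
  · obtain ⟨w, r', hw, hr', hle⟩ := h y ((Finset.mem_insert.1 (hs hy)).resolve_left hyx) r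
      (by simpa [Env.ext, hyx] using hr)
    have hwz : w ≠ z := by
      rintro rfl
      exact hz y hy hyx (by simp [hw, Expr.fv])
    exact ⟨w, r', by simpa [hyx] using hw, by simpa [Env.ext, hwz] using hr', hle⟩

/-- Renaming, weakening of environments, narrowing of types and substitution for untyped variables
in one induction. Quantifying over `Δ` and `θ` lets each binder receive a fresh name. Only typed
variables are constrained, because a derivation consults no others, even when they occur in an
ignored branch of a type-case. -/
theorem Decl.ssubst {Γ : Env B} {e : Expr C B 0} {t : Ty B} (h : Decl 𝓑 Γ e t) :
    ∀ {Δ : Env B} {θ : Var → Expr C B 0}, EnvRefines 𝓑 e.fv Γ Δ θ →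
      Decl 𝓑 Δ (e.ssubst θ) t := by
  induction h with
  | const Γ c => exact fun _ => .const _ c
  | ax Γ x t hx =>
    intro Δ θ hθ
    obtain ⟨z, t', hz, ht', hle⟩ := hθ x (by simp [Expr.fv]) t hx
    simp only [Expr.ssubst, hz, Expr.lift_fvar]
    exact .sub _ _ _ _ (.ax _ _ _ ht') hle
  | arrowI Γ x e m t _ ih =>
    intro Δ θ hθ
    obtain ⟨z, hz⟩ := Expr.exists_fresh e.fv θ
    rw [Expr.ssubst_abs θ x z e fun y hy _ => hz y hy]
    refine .arrowI _ _ _ _ _ (ih (hθ.ext ?_ (fun y hy _ => hz y hy) _))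
    simp only [Expr.abs, Expr.fv, Expr.fv_close]
    exact Finset.insert_erase_subset x _
  | arrowE Γ e₁ e₂ t₁ t₂ _ _ ih₁ ih₂ =>
    exact fun hθ => .arrowE _ _ _ _ _ (ih₁ (hθ.mono (by simp [Expr.fv])))
      (ih₂ (hθ.mono (by simp [Expr.fv])))
  | prodI Γ e₁ e₂ t₁ t₂ _ _ ih₁ ih₂ =>
    exact fun hθ => .prodI _ _ _ _ _ (ih₁ (hθ.mono (by simp [Expr.fv])))
      (ih₂ (hθ.mono (by simp [Expr.fv])))
  | prodE₁ Γ e t₁ t₂ _ ih => exact fun hθ => .prodE₁ _ _ _ _ (ih hθ)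
  | prodE₂ Γ e t₁ t₂ _ ih => exact fun hθ => .prodE₂ _ _ _ _ (ih hθ)
  | caseEmpty Γ e e₁ e₂ τ _ ih =>
    exact fun hθ => .caseEmpty _ _ _ _ _ (ih (hθ.mono (by simp [Expr.fv])))
  | case₁ Γ e e₁ e₂ τ t₁ _ _ ih ih₁ =>
    exact fun hθ => .case₁ _ _ _ _ _ _ (ih (hθ.mono (by simp [Expr.fv])))
      (ih₁ (hθ.mono (by intro; simp +contextual [Expr.fv])))
  | case₂ Γ e e₁ e₂ τ t₂ _ _ ih ih₂ =>
    exact fun hθ => .case₂ _ _ _ _ _ _ (ih (hθ.mono (by simp [Expr.fv])))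
      (ih₂ (hθ.mono (by intro; simp +contextual [Expr.fv])))
  | unionE Γ x e e' s m t _ _ _ ih ih₁ ih₂ =>
    intro Δ θ hθ
    -- If `x` occurs in `e`, the free variables of `e'` survive in the conclusion and the hypothesis
    -- on `θ` covers them. Otherwise `e'` has disappeared and nothing is known about its variables,
    -- so the first branch is used directly, without the entry for `x`.
    by_cases hx : x ∈ e.fv
    · obtain ⟨z, hz⟩ := Expr.exists_fresh e.fv θ
      rw [Expr.ssubst_subst θ x z e' e fun y hy _ => hz y hy]
      have hsub : e.fv ⊆ insert x (Expr.subst x e' e).fv := by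
        intro y hy
        by_cases hyx : y = x
        · simp [hyx]
        · exact Finset.mem_insert_of_mem (Expr.mem_fv_subst_of_ne e' hy hyx)
      exact .unionE _ _ _ _ _ _ _ (ih (hθ.mono fun y hy => Expr.mem_fv_subst hx hy))
        (ih₁ (hθ.ext hsub (fun y hy _ => hz y hy) _)) (ih₂ (hθ.ext hsub (fun y hy _ => hz y hy) _))
    · rw [Expr.subst_of_notMem_fv e' hx] at hθ ⊢
      refine ih₁ fun y hy r hr => hθ y hy r ?_
      have hyx : y ≠ x := fun h => hx (h ▸ hy)
      simpa [Env.ext, hyx] using hr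
  | interI Γ e t₁ t₂ _ _ ih₁ ih₂ => exact fun hθ => .interI _ _ _ _ (ih₁ hθ) (ih₂ hθ)
  | inst Γ e t σ _ ih => exact fun hθ => .inst _ _ _ _ (ih hθ)
  | sub Γ e t t' _ hle ih => exact fun hθ => .sub _ _ _ _ (ih hθ) hle

theorem Decl.env_mono {Γ : Env B} {x : Var} {e : Expr C B 0} {s s' t : Ty B}
    (h : Decl 𝓑 (Γ.ext x s) e t) (hs : IsSubtype 𝓑 s' s) : Decl 𝓑 (Γ.ext x s') e t := by
  rw [← Expr.ssubst_fvar e]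
  refine h.ssubst fun y _ r hr => ?_
  by_cases hyx : y = x
  · subst hyx
    obtain rfl : s = r := by simpa [Env.ext] using hr
    exact ⟨y, s', rfl, by simp [Env.ext], hs⟩
  · exact ⟨y, r, rfl, by simpa [Env.ext, hyx] using hr, fun _ => id⟩

/-- This handles skipped bindings: no typing of `e'` is required, since the derivation never looks
up `x`. -/
theorem Decl.subst_of_not_inDom {Γ : Env B} {x : Var} {e : Expr C B 0} {t : Ty B}
    (h : Decl 𝓑 Γ e t) (hx : ¬ Γ.InDom x) (e' : Expr C B 0) :
    Decl 𝓑 Γ (Expr.subst x e' e) t := by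
  rw [← Expr.ssubst_update_fvar]
  refine h.ssubst fun y _ r hr => ?_
  have hyx : y ≠ x := by
    rintro rfl
    exact hx ⟨r, hr⟩
  exact ⟨y, r, by simp [hyx], hr, fun _ => id⟩

/-- Union elimination with the trivial split along `any`; both branches assume a type below `s`. -/
theorem Decl.cut {Γ : Env B} {x : Var} {e e' : Expr C B 0} {s t : Ty B}
    (h' : Decl 𝓑 Γ e' s) (h : Decl 𝓑 (Γ.ext x s) e t) : Decl 𝓑 Γ (Expr.subst x e' e) t :=
  .unionE _ _ _ _ s ⟨.any, Ty.isMono_any⟩ _ h'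
    (h.env_mono fun _ hd => ((mem_inter ..).1 hd).1)
    (h.env_mono fun _ hd => ((mem_inter ..).1 hd).1)

/-- Binary splits are iterated on `x` itself, writing `e` as `e{x/x}`: one branch assumes `m`, and
in the other the remaining types cover what is left. The list must be nonempty, for otherwise an
empty `s` would satisfy the covering condition with no derivation for `e` available. -/
theorem Decl.union_cover {Γ : Env B} {x : Var} {e : Expr C B 0} {t : Ty B}
    (l : List (MonoTy B)) (hl : l ≠ []) (s : Ty B)
    (hs : ∀ d, Mem 𝓑 d s → ∃ m ∈ l, Mem 𝓑 d m.1)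
    (h : ∀ m ∈ l, Decl 𝓑 (Γ.ext x (.inter s m.1)) e t) : Decl 𝓑 (Γ.ext x s) e t := by
  induction l generalizing s with
  | nil => exact (hl rfl).elim
  | cons m l ih =>
    by_cases hl' : l = []
    · subst hl'
      exact (h m (by simp)).env_mono fun d hd =>
        (mem_inter ..).2 ⟨hd, by simpa using hs d hd⟩
    · have hext : ∀ r : Ty B, (Γ.ext x s).ext x r = Γ.ext x r := fun r => by simp [Env.ext]
      rw [← Expr.subst_fvar_self x e]
      refine .unionE _ x e (.fvar x) s m t (.ax _ _ _ (by simp [Env.ext])) ?_ ?_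
      · rw [hext]
        exact h m (by simp)
      · rw [hext]
        refine ih hl' _ (fun d hd => ?_) fun m' hm' => (h m' (by simp [hm'])).env_mono fun d hd => ?_
        · simp only [mem_inter, mem_neg] at hd
          simpa [hd.2] using hs d hd.1
        · simp only [mem_inter] at hd ⊢
          exact ⟨hd.1.1, hd.2⟩

theorem Decl.any {Γ : Env B} {e : Expr C B 0} {t : Ty B} (h : Decl 𝓑 Γ e t) :
    Decl 𝓑 Γ e .any := .sub _ _ _ _ h (isSubtype_any t)

/-- Finite intersections end in `any`, and an expression receives `any` only if it has some type;
hence the separate assumption. -/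
theorem Decl.bigInter {Γ : Env B} {e : Expr C B 0} {l : List (Ty B)} (h₀ : Decl 𝓑 Γ e .any)
    (h : ∀ t ∈ l, Decl 𝓑 Γ e t) : Decl 𝓑 Γ e (.bigInter l) := by
  induction l with
  | nil => exact h₀
  | cons t l ih =>
    exact .interI _ _ _ _ (h t (by simp)) (ih fun s hs => h s (by simp [hs]))

theorem Decl.instSet {Γ : Env B} {e : Expr C B 0} {t : Ty B} (h : Decl 𝓑 Γ e t)
    (S : List (PSubst B)) : Decl 𝓑 Γ e (t.instSet S) := by
  refine .bigInter h.any fun s hs => ?_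
  obtain ⟨σ, -, rfl⟩ := List.mem_map.1 hs
  exact .inst _ _ _ _ h

theorem Decl.iInter {Γ : Env B} {e : Expr C B 0} {n : ℕ} (hn : n ≠ 0) {t : Fin n → Ty B}
    (h : ∀ i, Decl 𝓑 Γ e (t i)) : Decl 𝓑 Γ e (Ty.iInter t) := by
  refine .bigInter (h ⟨0, Nat.pos_of_ne_zero hn⟩).any fun s hs => ?_
  obtain ⟨i, rfl⟩ := List.mem_ofFn.1 hs
  exact h i

theorem Decl.iUnion {Γ : Env B} {x : Var} {e e' : Expr C B 0} {s : Ty B} {n : ℕ}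
    {ms : Fin n → MonoTy B} {t : Fin n → Ty B} (h' : Decl 𝓑 Γ e' s)
    (h : ∀ i, Decl 𝓑 (Γ.ext x (.inter s (ms i).1)) e (t i))
    (hcover : IsEquiv 𝓑 (Ty.iUnion fun i => (ms i).1) .any) :
    Decl 𝓑 Γ (Expr.subst x e' e) (Ty.iUnion t) := by
  have hex : ∀ d, ∃ i, Mem 𝓑 d (ms i).1 := fun d => by
    simpa [Ty.iUnion, mem_bigUnion] using hcover.2 d (mem_any 𝓑 d)
  refine h'.cut (.union_cover (List.ofFn ms) ?_ s (fun d _ => ?_) fun m hm => ?_)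
  -- The empty relation witnesses that the interpretation of `any` is inhabited, so the cover has at
  -- least one member.
  · obtain ⟨i, -⟩ := hex (.rel 0 Fin.elim0 Fin.elim0 ∅)
    exact List.ne_nil_of_mem (List.mem_ofFn.2 ⟨i, rfl⟩)
  · obtain ⟨i, hi⟩ := hex d
    exact ⟨ms i, List.mem_ofFn.2 ⟨i, rfl⟩, hi⟩
  · obtain ⟨i, rfl⟩ := List.mem_ofFn.1 hm
    exact .sub _ _ _ _ (h i) fun d hd =>
      (mem_bigUnion ..).2 ⟨t i, List.mem_ofFn.2 ⟨i, rfl⟩, hd⟩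

/-! ### Soundness of the algorithmic system -/

mutual
-- The type operators enter through the inequality that their value satisfies, such as `t₁ ≤ t₂ → u`
-- for an application: subsumption along it prepares the declarative elimination rule.
theorem AlgAtom.decl {Γ : Env B} {a : Atom C B} {k : AtomAnnot B} {t : Ty B} :
    AlgAtom 𝓑 Γ a k t → Decl 𝓑 Γ a.unwind t
  | .const Γ c => by rw [Atom.unwind]; exact .const Γ c
  | .ax Γ x t hx => by rw [Atom.unwind]; exact .ax Γ _ t hx
  | .arrowI Γ x κ m k t h => by rw [Atom.unwind]; exact .arrowI Γ _ _ m t h.decl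
  | .arrowE Γ x₁ x₂ S₁ S₂ s₁ s₂ t₁ t₂ d u hx₁ hx₂ ht₁ ht₂ _ _ _ hu => by
    subst ht₁ ht₂
    rw [Atom.unwind]
    exact .arrowE _ _ _ _ _ (.sub _ _ _ _ (.instSet (.ax _ _ _ hx₁) S₁) hu.1)
      (.instSet (.ax _ _ _ hx₂) S₂)
  | .prodI Γ x₁ x₂ ρ₁ ρ₂ s₁ s₂ hx₁ hx₂ => by
    rw [Atom.unwind]
    exact .prodI _ _ _ _ _ (.inst _ _ _ _ (.ax _ _ _ hx₁)) (.inst _ _ _ _ (.ax _ _ _ hx₂))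
  | .prodE Γ i x S s t u hx ht _ hu => by
    subst ht
    rw [Atom.unwind]
    have h : Decl 𝓑 Γ _ _ := .sub _ _ _ _ (.instSet (.ax _ _ _ hx) S) hu.1
    cases i with
    | false => exact .prodE₁ _ _ _ _ h
    | true => exact .prodE₂ _ _ _ _ h
  | .caseEmpty Γ x τ x₁ x₂ S s hx h => by
    rw [Atom.unwind]
    exact .caseEmpty _ _ _ _ _ (.sub _ _ _ _ (.instSet (.ax _ _ _ hx) S) h.1)
  | .case₁ Γ x τ x₁ x₂ S s t₁ hx h hx₁ => by
    rw [Atom.unwind]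
    exact .case₁ _ _ _ _ _ _ (.sub _ _ _ _ (.instSet (.ax _ _ _ hx) S) h) (.ax _ _ _ hx₁)
  | .case₂ Γ x τ x₁ x₂ S s t₂ hx h hx₂ => by
    rw [Atom.unwind]
    exact .case₂ _ _ _ _ _ _ (.sub _ _ _ _ (.instSet (.ax _ _ _ hx) S) h) (.ax _ _ _ hx₂)
  | .inter Γ a n as t hn h => .iInter hn fun i => (h i).decl

theorem AlgForm.decl {Γ : Env B} {κ : Form C B} {k : FormAnnot B} {t : Ty B} :
    AlgForm 𝓑 Γ κ k t → Decl 𝓑 Γ κ.unwind t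
  | .var Γ x ρ s hx => by rw [Form.unwind]; exact .inst _ _ _ _ (.ax _ _ _ hx)
  | .bind₁ Γ x a κ k t hx h => by rw [Form.unwind]; exact h.decl.subst_of_not_inDom hx _
  | .bind₂ Γ x a κ a' n ms ks s t ha h hcover => by
    rw [Form.unwind]
    exact .iUnion ha.decl (fun i => (h i).decl) hcover
  | .inter Γ κ n ks t hn h => .iInter hn fun i => (h i).decl
end

end Declarative

end PolyDyn

theorem mainTheorem4 {C : Type*} {B : Type*} (𝓑 : PolyDyn.BasicTypes C B) (Γ : PolyDyn.Env B) :
    (∀ (κ : PolyDyn.Form C B) (b : PolyDyn.FormIAnnot B) (k : PolyDyn.FormAnnot B),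
      PolyDyn.ReconForm 𝓑 Γ κ b k →
        ∃ t, PolyDyn.AlgForm 𝓑 Γ κ k t ∧ PolyDyn.Decl 𝓑 Γ κ.unwind t) ∧
    (∀ (a : PolyDyn.Atom C B) (l : PolyDyn.AtomIAnnot B) (k : PolyDyn.AtomAnnot B),
      PolyDyn.ReconAtom 𝓑 Γ a l k →
        ∃ t, PolyDyn.AlgAtom 𝓑 Γ a k t ∧ PolyDyn.Decl 𝓑 Γ a.unwind t) := by
  refine ⟨fun κ b k h => ?_, fun a l k h => ?_⟩
  · obtain ⟨t, ht⟩ := h.exists_algForm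
    exact ⟨t, ht, ht.decl⟩
  · obtain ⟨t, ht⟩ := h.exists_algAtom
    exact ⟨t, ht, ht.decl⟩
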